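/- Let $d\ge 1$. A *necklace* is a cube $C=[\alpha_1,\alpha_1+\alpha_0]\times\dots\times[\alpha_d,\alpha_d+\alpha_0]\subset\mathbb{R}^d$ with $\alpha_0>0$. A *measurable $k$-coloring* of $C$ (or of $\mathbb{R}^d$) is a map to $\{1,\dots,k\}$ all of whose color classes are Lebesgue measurable. A *fair $q$-splitting* of a $k$-colored necklace $C$ using at most $t$ axis-aligned hyperplane cuts is a division of $C$ into cuboids by at most $t$ hyperplanes, each perpendicular to one of the coordinate axes, together with a distribution of these cuboids into $q$ parts such that each part contains exactly $1/q$ of the total Lebesgue measure of every color in $C$. **Theorem.** Let $d,k,t\ge 1$ and $q\ge 2$ be integers with $k(q-1)>t+q-2$, and let $C\subset\mathbb{R}^d$ be any necklace. Then there is a measurable $k$-coloring of $C$ that has no fair $q$-splitting using at most $t$ axis-aligned hyperplane cuts. The set of such colorings is dense in the metric space of all measurable $k$-colorings of $C$ with the distance $\mathcal{L}(\{x\in C: f(x)\neq g(x)\})$, where $\mathcal{L}$ is the Lebesgue measure. Likewise, the set of measurable $k$-colorings of $\mathbb{R}^d$ whose restriction to $C$ has no such splitting is dense in the metric space of all measurable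 $k$-colorings of $\mathbb{R}^d$ with the distance $$d(f,g)=\sum_{n=1}^{\infty}\frac{1}{2^n}\cdot\frac{\mathcal{L}(\{x\in[-n,n]^d: f(x)\ne g(x)\})}{(2n)^d}.$$ (In both spaces colorings that agree almost everywhere are identified.) For $q=2$ this is tight: for all $d,t\ge 1$ and every necklace $C\subset\mathbb{R}^d$, the smallest $k$ for which some measurable $k$-coloring of $C$ has no fair $2$-splitting using at most $t$ axis-aligned hyperplane cuts is $k=t+1$. -/

import Mathlib

open MeasureTheory

noncomputable section

namespace NecklaceSplitting

/-- A `d`-dimensional necklace: a nontrivial axis-aligned cube in `ℝ^d`. -/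
structure Necklace (d : ℕ) where
  corner : Fin d → ℝ
  side : ℝ
  side_pos : 0 < side

/-- The closed cube `[α₁, α₁ + α₀] × ⋯ × [α_d, α_d + α₀]`. -/
def Necklace.toSet {d : ℕ} (C : Necklace d) : Set (Fin d → ℝ) :=
  Set.Icc C.corner (fun i => C.corner i + C.side)

/-- A measurable `k`-coloring of the necklace `C`: a map from the cube to the set of `k` colors,
all of whose color classes are Lebesgue measurable subsets of `ℝ^d`
(`NullMeasurableSet` for `volume` is Lebesgue measurability, with respect to the completion). -/
structure Coloring {d : ℕ} (C : Necklace d) (k : ℕ) where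
  color : C.toSet → Fin k
  measurable : ∀ c : Fin k, NullMeasurableSet (Subtype.val '' (color ⁻¹' {c})) volume

/-- The set of points of the cube that have color `c`. -/
def Coloring.colorClass {d k : ℕ} {C : Necklace d} (f : Coloring C k) (c : Fin k) :
    Set (Fin d → ℝ) :=
  Subtype.val '' (f.color ⁻¹' {c})

/-- A division of the cube `C` by axis-aligned hyperplanes, together with a splitting of the
resulting cuboids into `q` parts. There are `cuts i` hyperplanes aligned to the `i`-th axis; their
`i`-th coordinates are `pos i 1 ≤ ⋯ ≤ pos i (cuts i)`, while `pos i 0` and `pos i (cuts i + 1)` are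
the two ends of the projection of the cube to the `i`-th axis. -/
structure Splitting {d : ℕ} (C : Necklace d) (q : ℕ) where
  cuts : Fin d → ℕ
  pos : (i : Fin d) → Fin (cuts i + 2) → ℝ
  pos_monotone : ∀ i, Monotone (pos i)
  pos_first : ∀ i, pos i 0 = C.corner i
  pos_last : ∀ i, pos i (Fin.last (cuts i + 1)) = C.corner i + C.side
  label : ((i : Fin d) → Fin (cuts i + 1)) → Fin q

namespace Splitting

variable {d : ℕ} {C : Necklace d} {q : ℕ}

/-- The size of a splitting: the total number of hyperplane cuts. -/
def size (s : Splitting C q) : ℕ := ∑ i, s.cuts i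

/-- The cuboid of the division with index `j = (j₁, …, j_d)`. -/
def piece (s : Splitting C q) (j : (i : Fin d) → Fin (s.cuts i + 1)) : Set (Fin d → ℝ) :=
  Set.Icc (fun i => s.pos i (j i).castSucc) (fun i => s.pos i (j i).succ)

/-- The `l`-th part of the splitting: the union of all cuboids labeled `l`. (Different cuboids
meet in a set of measure zero.) -/
def part (s : Splitting C q) (l : Fin q) : Set (Fin d → ℝ) :=
  ⋃ j ∈ {j | s.label j = l}, s.piece j

/-- A splitting is fair if each of the `q` parts captures exactly `1 / q` of the total measure of
every color. -/
def IsFair {k : ℕ} (s : Splitting C q) (f : Coloring C k) : Prop :=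
  ∀ (l : Fin q) (c : Fin k),
    volume (f.colorClass c ∩ s.part l) = volume (f.colorClass c) / (q : ENNReal)

end Splitting

/-- The colored necklace has a fair `q`-splitting using at most `t` axis-aligned hyperplane
cuts. -/
def HasFairSplitting {d k : ℕ} {C : Necklace d} (f : Coloring C k) (q t : ℕ) : Prop :=
  ∃ s : Splitting C q, s.size ≤ t ∧ s.IsFair f

/-- The set of points of the cube at which two colorings of it differ. -/
def Coloring.disagreement {d k : ℕ} {C : Necklace d} (f g : Coloring C k) : Set (Fin d → ℝ) :=
  Subtype.val '' {x | f.color x ≠ g.color x}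

theorem Coloring.volume_disagreement_ne_top {d k : ℕ} {C : Necklace d} (f g : Coloring C k) :
    volume (f.disagreement g) ≠ ⊤ := by
  have h : volume C.toSet < ⊤ := isCompact_Icc.measure_lt_top
  refine ((measure_mono ?_).trans_lt h).ne
  rintro _ ⟨x, -, rfl⟩
  exact x.2

/-- The distance between two colorings of a cube is the Lebesgue measure of the set on which they
differ. -/
instance {d k : ℕ} (C : Necklace d) : PseudoMetricSpace (Coloring C k) where
  dist f g := volume.real (f.disagreement g)
  dist_self f := by simp [Coloring.disagreement]
  dist_comm f g := by simp only [Coloring.disagreement, ne_comm]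
  dist_triangle f g h := by
    refine le_trans (measureReal_mono ?_ ?_) (measureReal_union_le _ _)
    · rintro _ ⟨x, hx, rfl⟩
      by_cases hfg : f.color x = g.color x
      · exact Or.inr ⟨x, fun e => hx (hfg.trans e), rfl⟩
      · exact Or.inl ⟨x, hfg, rfl⟩
    · exact measure_union_ne_top (f.volume_disagreement_ne_top g) (g.volume_disagreement_ne_top h)

/-- The metric space of measurable `k`-colorings of the cube `C`, where colorings at distance zero
are identified. -/
abbrev ColoringSpace {d : ℕ} (C : Necklace d) (k : ℕ) : Type :=
  SeparationQuotient (Coloring C k)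

/-- A measurable `k`-coloring of the whole space `ℝ^d`. -/
structure GlobalColoring (d k : ℕ) where
  color : (Fin d → ℝ) → Fin k
  measurable : ∀ c : Fin k, NullMeasurableSet (color ⁻¹' {c}) volume

namespace GlobalColoring

variable {d k : ℕ}

/-- The restriction of a coloring of `ℝ^d` to a cube. -/
def restrict (f : GlobalColoring d k) (C : Necklace d) : Coloring C k where
  color x := f.color x
  measurable c := by
    have h : Subtype.val '' ((fun x : C.toSet => f.color x) ⁻¹' {c})
        = f.color ⁻¹' {c} ∩ C.toSet := by
      ext x
      simp [and_comm]
    rw [h]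
    exact (f.measurable c).inter measurableSet_Icc.nullMeasurableSet

/-- The set `D_n(f, g)` of points of `[-n, n]^d` at which `f` and `g` differ. -/
def diffSet (f g : GlobalColoring d k) (n : ℕ) : Set (Fin d → ℝ) :=
  {x | x ∈ Set.Icc (fun _ => -(n : ℝ)) (fun _ => (n : ℝ)) ∧ f.color x ≠ g.color x}

/-- The normalized distance `d_n(f, g)` on `[-n, n]^d`. -/
def distOn (f g : GlobalColoring d k) (n : ℕ) : ℝ :=
  volume.real (f.diffSet g n) / (2 * (n : ℝ)) ^ d

theorem volume_diffSet_ne_top (f g : GlobalColoring d k) (n : ℕ) :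
    volume (f.diffSet g n) ≠ ⊤ := by
  have h : volume (Set.Icc (fun _ : Fin d => -(n : ℝ)) (fun _ => (n : ℝ))) < ⊤ :=
    isCompact_Icc.measure_lt_top
  exact ((measure_mono fun x hx => hx.1).trans_lt h).ne

theorem distOn_nonneg (f g : GlobalColoring d k) (n : ℕ) : 0 ≤ f.distOn g n := by
  unfold distOn
  positivity

theorem distOn_le_one (f g : GlobalColoring d k) (n : ℕ) : f.distOn g n ≤ 1 := by
  refine div_le_one_of_le₀ ?_ (by positivity)
  have h : volume (Set.Icc (fun _ : Fin d => -(n : ℝ)) (fun _ => (n : ℝ))) < ⊤ :=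
    isCompact_Icc.measure_lt_top
  refine (measureReal_mono (fun x hx => hx.1) h.ne).trans ?_
  rw [measureReal_def, Real.volume_Icc_pi_toReal]
  · simp [two_mul]
  · intro i
    have : (0 : ℝ) ≤ n := Nat.cast_nonneg n
    simp only
    linarith

theorem distOn_triangle (f g h : GlobalColoring d k) (n : ℕ) :
    f.distOn h n ≤ f.distOn g n + g.distOn h n := by
  unfold distOn
  rw [← add_div]
  refine div_le_div_of_nonneg_right ?_ (by positivity)
  refine le_trans (measureReal_mono ?_ ?_) (measureReal_union_le _ _)
  · rintro x ⟨hx, hne⟩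
    by_cases hfg : f.color x = g.color x
    · exact Or.inr ⟨hx, fun e => hne (hfg.trans e)⟩
    · exact Or.inl ⟨hx, hfg⟩
  · exact measure_union_ne_top (f.volume_diffSet_ne_top g n) (g.volume_diffSet_ne_top h n)

theorem summable_distOn (f g : GlobalColoring d k) :
    Summable fun n : ℕ => f.distOn g (n + 1) / 2 ^ (n + 1) := by
  refine Summable.of_nonneg_of_le (fun n => div_nonneg (distOn_nonneg f g _) (by positivity))
    (fun n => ?_) ((summable_nat_add_iff 1).2 summable_geometric_two)
  rw [one_div, inv_pow, ← one_div]
  exact div_le_div_of_nonneg_right (distOn_le_one f g _) (by positivity)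

/-- The distance `d(f, g) = ∑_{n ≥ 1} d_n(f, g) / 2^n` between colorings of `ℝ^d` (the summation
index is shifted by one). -/
instance : PseudoMetricSpace (GlobalColoring d k) where
  dist f g := ∑' n : ℕ, f.distOn g (n + 1) / 2 ^ (n + 1)
  dist_self f := by simp [distOn, diffSet]
  dist_comm f g := by simp only [distOn, diffSet, ne_comm]
  dist_triangle f g h := by
    rw [← (summable_distOn f g).tsum_add (summable_distOn g h)]
    refine (summable_distOn f h).tsum_le_tsum (fun n => ?_)
      ((summable_distOn f g).add (summable_distOn g h))
    rw [← add_div]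
    exact div_le_div_of_nonneg_right (distOn_triangle f g h _) (by positivity)

end GlobalColoring

/-- The metric space of measurable `k`-colorings of `ℝ^d`, where colorings at distance zero are
identified. -/
abbrev GlobalColoringSpace (d k : ℕ) : Type :=
  SeparationQuotient (GlobalColoring d k)

end NecklaceSplitting

end

open NecklaceSplitting

/-! Colorings without fair splittings come from counting degrees of freedom. The hypothesis says `t
≤ (q - 1) * (k - 1)`. Fix a part `l₀` and a color `c₀`. Equal amounts of each color `c ≠ c₀` in each
part `l ≠ l₀` and in `l₀` give `(q - 1) * (k - 1)` equations, at least as many as there are cut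
positions. Summing fairness over all colors gives one more: `l₀` has a `q`-th of the volume of the
cube. This equation does not involve the coloring.

To make the equations independent, a given coloring is perturbed. Each cell of a fine grid receives
one tiny box per color, and the box gets its own color below a threshold and `c₀` above it. In a
fair splitting every part contains a whole cell up to a null set, hence a box of each color. The
cuts are matched injectively with pairs `(l, c)`, `l ≠ l₀`, `c ≠ c₀`, and so with distinct boxes.
The balance equations then express the thresholds of these boxes as Lipschitz functions of the cut
positions and of the other thresholds (`solveThresholds_extend`). So the bad thresholds lie in a
countable union of Lipschitz images of subsets of a space of the same dimension. The volume equation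
puts these subsets in zero sets of nonzero polynomials (`volume_partPoly_eq_zero`), which are null.
Almost all thresholds are therefore good, and the boxes can be made arbitrarily small, which gives
density.

For tightness with `q = 2`, any `k ≤ t` colors are bisected by `k` cuts perpendicular to one axis,
which is the Hobby–Rice theorem (`exists_cutImbalance_eq_zero`). Its discrete core is a mod 2
substitute for Borsuk–Ulam (`sum_changeProd_vertex`). Among the walks that push `k` cuts one cell
further, one after the other, an odd number have the `m`-th antipodal function change at the `m`-th
move for every `m`. Applied to signs of imbalances on finer and finer grids, this gives almost
balanced cuts, and compactness gives exact ones. -/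

noncomputable section

namespace NecklaceSplitting

/-! ### A parity lemma for antipodal functions on sign vectors -/

/-- Omits the index `j`. -/
def skip (j m : ℕ) : ℕ := if m < j then m else m + 1

/-- The product of the sign changes of `u m` between consecutive vertices `y m`, `y (m + 1)`. -/
def changeProd {V : Type*} (u : ℕ → V → ZMod 2) (k : ℕ) (y : ℕ → V) : ZMod 2 :=
  ∏ m ∈ Finset.range k, (u m (y m) + u m (y (m + 1)))

theorem changeProd_succ {V : Type*} (u : ℕ → V → ZMod 2) (k : ℕ) (y : ℕ → V) :
    changeProd u (k + 1) y = changeProd u k y * (u k (y k) + u k (y (k + 1))) :=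
  Finset.prod_range_succ _ _

theorem changeProd_congr {V : Type*} (u : ℕ → V → ZMod 2) (k : ℕ) {y z : ℕ → V}
    (h : ∀ m ≤ k, y m = z m) : changeProd u k y = changeProd u k z := by
  refine Finset.prod_congr rfl fun m hm => ?_
  have := Finset.mem_range.1 hm
  rw [h m (by omega), h (m + 1) (by omega)]

/-- `changeProd u k` is the cup product mod 2 of the coboundaries of the `u m`, hence a cocycle. The
right side is the face omitting the last vertex. -/
theorem sum_changeProd_skip {V : Type*} (u : ℕ → V → ZMod 2) (k : ℕ) (y : ℕ → V) :
    ∑ j ∈ Finset.range (k + 1), changeProd u k (fun m => y (skip j m)) = changeProd u k y := by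
  induction k with
  | zero => simp [changeProd]
  | succ k ih =>
    rw [Finset.sum_range_succ]
    have h1 : ∀ j ∈ Finset.range (k + 1), changeProd u (k + 1) (fun m => y (skip j m))
        = changeProd u k (fun m => y (skip j m)) * (u k (y (k + 1)) + u k (y (k + 2))) := by
      intro j hj
      have := Finset.mem_range.1 hj
      rw [changeProd_succ]
      simp only [skip, if_neg (show ¬ k < j by omega), if_neg (show ¬ k + 1 < j by omega)]
    rw [Finset.sum_congr rfl h1, ← Finset.sum_mul, ih, changeProd_succ, changeProd_succ]
    have h2 : changeProd u k (fun m => y (skip (k + 1) m)) = changeProd u k y :=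
      changeProd_congr u k fun m hm => by simp [skip, show m < k + 1 by omega]
    rw [h2]
    simp only [skip, lt_add_one, if_true, lt_irrefl, if_false]
    have : u k (y (k + 1 + 1)) + u k (y (k + 1 + 1)) = 0 := CharTwo.add_self_eq_zero _
    linear_combination changeProd u k y * this

/-- The coboundary formula: a product of `k + 1` sign changes is the coboundary of a product of
`k` sign changes with the last function. -/
theorem changeProd_succ_eq_sum {V : Type*} (u : ℕ → V → ZMod 2) (k : ℕ) (y : ℕ → V) :
    changeProd u (k + 1) y = ∑ j ∈ Finset.range (k + 2),
      changeProd u k (fun m => y (skip j m)) * u k (y (skip j k)) := by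
  rw [Finset.sum_range_succ]
  have h1 : ∀ j ∈ Finset.range (k + 1),
      changeProd u k (fun m => y (skip j m)) * u k (y (skip j k))
        = changeProd u k (fun m => y (skip j m)) * u k (y (k + 1)) := by
    intro j hj
    have := Finset.mem_range.1 hj
    simp only [skip, if_neg (show ¬ k < j by omega)]
  have h2 : changeProd u k (fun m => y (skip (k + 1) m)) = changeProd u k y :=
    changeProd_congr u k fun m hm => by simp [skip, show m < k + 1 by omega]
  rw [Finset.sum_congr rfl h1, ← Finset.sum_mul, sum_changeProd_skip, h2, changeProd_succ]
  simp only [skip, lt_add_one, if_true]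
  ring

/-- The sign vector with a single sign change before the cell `c`. -/
def stepVec (N c : ℕ) : Fin N → ZMod 2 := fun x => if c ≤ (x : ℕ) then 1 else 0

theorem stepVec_zero (N : ℕ) : stepVec N 0 = 1 := by
  ext x
  simp [stepVec]

theorem stepVec_self (N : ℕ) : stepVec N N = 0 := by
  ext x
  simp [stepVec, x.2]

theorem stepVec_succ (N : ℕ) (c : Fin N) :
    stepVec N (c + 1) = stepVec N c + Pi.single c 1 := by
  ext x
  by_cases hx : x = c
  · subst hx
    simp [stepVec, CharTwo.add_self_eq_zero]
  · have : (x : ℕ) ≠ c := fun h => hx (Fin.ext h)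
    simp only [stepVec, Pi.add_apply, Pi.single_eq_of_ne hx, add_zero]
    congr 1
    simp only [eq_iff_iff]
    omega

/-- The sign vector obtained from the cuts before the cells `a i` by moving the first `m` cuts one
cell further. -/
def vertex {N k : ℕ} (a : Fin k → Fin N) (m : ℕ) : Fin N → ZMod 2 :=
  ∑ i : Fin k, stepVec N (if (i : ℕ) < m then a i + 1 else a i)

theorem vertex_succ {N k : ℕ} (a : Fin k → Fin N) (i : Fin k) :
    vertex a (i + 1) = vertex a i + Pi.single (a i) 1 := by
  unfold vertex
  rw [← Finset.add_sum_erase _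
      (fun j : Fin k => stepVec N (if (j : ℕ) < i + 1 then a j + 1 else a j)) (Finset.mem_univ i),
    ← Finset.add_sum_erase _ (fun j : Fin k => stepVec N (if (j : ℕ) < i then a j + 1 else a j))
      (Finset.mem_univ i)]
  simp only [lt_add_one, if_true, lt_irrefl, if_false, stepVec_succ]
  rw [add_right_comm, add_left_inj, add_right_inj]
  refine Finset.sum_congr rfl fun j hj => ?_
  have : (j : ℕ) ≠ i := fun h => Finset.ne_of_mem_erase hj (Fin.ext h)
  congr 2
  simp only [eq_iff_iff]
  omega

theorem vertex_cons {N k : ℕ} (c : Fin N) (b : Fin k → Fin N) (m : ℕ) :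
    vertex (Fin.cons c b : Fin (k + 1) → Fin N) (m + 1) = vertex b m + stepVec N (c + 1) := by
  simp [vertex, Fin.sum_univ_succ, add_comm]

theorem vertex_snoc {N k : ℕ} (c : Fin N) (b : Fin k → Fin N) {m : ℕ} (hm : m ≤ k) :
    vertex (Fin.snoc b c : Fin (k + 1) → Fin N) m = vertex b m + stepVec N c := by
  simp [vertex, Fin.sum_univ_castSucc, not_lt.2 hm]

/-- Exchanging two adjacent moves affects only the vertex between them. This pairs off the interior
faces of the walks. -/
theorem vertex_swap {N k : ℕ} (a : Fin (k + 1) → Fin N) (j : Fin k) {m : ℕ} (hm : m ≠ j + 1) :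
    vertex (a ∘ Equiv.swap j.castSucc j.succ) m = vertex a m := by
  unfold vertex
  refine Fintype.sum_equiv (Equiv.swap j.castSucc j.succ) _ _ fun i => ?_
  simp only [Function.comp_apply]
  congr 1
  have : (i : ℕ) < m ↔ ((Equiv.swap j.castSucc j.succ i : Fin (k + 1)) : ℕ) < m := by
    rcases eq_or_ne i j.castSucc with h | h
    · subst h
      simp
      omega
    · rcases eq_or_ne i j.succ with h' | h'
      · subst h'
        simp
        omega
      · rw [Equiv.swap_apply_of_ne_of_ne h h']
  by_cases h : (i : ℕ) < m
  · rw [if_pos h, if_pos (this.1 h)]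
  · rw [if_neg h, if_neg (fun h' => h (this.2 h'))]

/-- For antipodal `u m`, the number of sequences of cuts such that `u m` changes at the `m`-th
move, for all `m`, is odd. -/
theorem sum_changeProd_vertex (N : ℕ) (u : ℕ → (Fin N → ZMod 2) → ZMod 2)
    (hu : ∀ m v, u m (v + 1) = u m v + 1) (k : ℕ) :
    ∑ a : Fin k → Fin N, changeProd u k (vertex a) = 1 := by
  induction k with
  | zero => simp [changeProd]
  | succ k ih =>
    set φ : (ℕ → Fin N → ZMod 2) → ZMod 2 := fun y => changeProd u k y * u k (y k) with hφ
    -- Interior faces cancel mod 2: exchanging the two moves around the omitted vertex is an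
    -- involution that preserves the term.
    have hmid : ∀ j ∈ Finset.range k,
        ∑ a : Fin (k + 1) → Fin N, φ (fun m => vertex a (skip (j + 1) m)) = 0 := by
      intro j hj
      have hj := Finset.mem_range.1 hj
      have hs : ∀ m, skip (j + 1) m ≠ j + 1 := by
        intro m
        unfold skip
        split_ifs <;> omega
      refine Finset.sum_involution
        (fun a _ => a ∘ Equiv.swap (⟨j, hj⟩ : Fin k).castSucc (⟨j, hj⟩ : Fin k).succ) ?_ ?_
        (fun a _ => Finset.mem_univ _) ?_
      · intro a _
        have : (fun m => vertex (a ∘ Equiv.swap (⟨j, hj⟩ : Fin k).castSucc (⟨j, hj⟩ : Fin k).succ)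
            (skip (j + 1) m)) = fun m => vertex a (skip (j + 1) m) :=
          funext fun m => vertex_swap a ⟨j, hj⟩ (hs m)
        simp only [this]
        exact CharTwo.add_self_eq_zero _
      · intro a _ hne heq
        apply hne
        -- At a fixed point both moves flip the same cell, so the walk returns to where it was and
        -- the face has a vanishing factor.
        have ha : a (⟨j, hj⟩ : Fin k).castSucc = a (⟨j, hj⟩ : Fin k).succ := by
          have := congrFun heq (⟨j, hj⟩ : Fin k).succ
          simpa using this
        have hv : vertex a (j + 2) = vertex a j := by
          have h1 := vertex_succ a (⟨j, hj⟩ : Fin k).castSucc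
          have h2 := vertex_succ a (⟨j, hj⟩ : Fin k).succ
          simp only [Fin.val_castSucc, Fin.val_succ] at h1 h2
          rw [h2, h1, ha, add_assoc, ← Pi.single_add, CharTwo.add_self_eq_zero, Pi.single_zero, add_zero]
        have : changeProd u k (fun m => vertex a (skip (j + 1) m)) = 0 := by
          refine Finset.prod_eq_zero (Finset.mem_range.2 hj) ?_
          simp [skip, hv, CharTwo.add_self_eq_zero]
        simp [hφ, this]
      · intro a _
        ext i
        simp
    have hfirst : ∑ a : Fin (k + 1) → Fin N, φ (fun m => vertex a (skip 0 m))
        = ∑ b : Fin k → Fin N, ∑ c : Fin N, φ (fun m => vertex b m + stepVec N (c + 1)) := by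
      rw [← (Fin.consEquiv fun _ => Fin N).sum_comp, Fintype.sum_prod_type_right]
      refine Finset.sum_congr rfl fun b _ => Finset.sum_congr rfl fun c _ => ?_
      congr 1
      funext m
      simp only [skip, Nat.not_lt_zero, if_false, Fin.consEquiv, Equiv.coe_fn_mk]
      exact vertex_cons c b m
    have hlast : ∑ a : Fin (k + 1) → Fin N, φ (fun m => vertex a (skip (k + 1) m))
        = ∑ b : Fin k → Fin N, ∑ c : Fin N, φ (fun m => vertex b m + stepVec N c) := by
      rw [← (Fin.snocEquiv fun _ => Fin N).sum_comp, Fintype.sum_prod_type_right]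
      refine Finset.sum_congr rfl fun b _ => Finset.sum_congr rfl fun c _ => ?_
      have h : ∀ m ≤ k, vertex (Fin.snocEquiv (fun _ => Fin N) (c, b)) (skip (k + 1) m)
          = vertex b m + stepVec N c := by
        intro m hm
        simp only [skip, if_pos (Nat.lt_succ_of_le hm)]
        exact vertex_snoc c b hm
      simp only [hφ]
      rw [changeProd_congr u k h, h k le_rfl]
    -- The first and last faces differ by pushing one extra cut from `c` to `c + 1`, so the sum over
    -- `c` telescopes to the extra cut at `0` and at `N`. These are antipodal vertices: the product
    -- is unchanged there while `u k` flips.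
    have htel : ∀ b : Fin k → Fin N, (∑ c : Fin N, φ (fun m => vertex b m + stepVec N (c + 1)))
        + ∑ c : Fin N, φ (fun m => vertex b m + stepVec N c) = changeProd u k (vertex b) := by
      intro b
      rw [Fin.sum_univ_eq_sum_range (fun c => φ (fun m => vertex b m + stepVec N (c + 1))),
        Fin.sum_univ_eq_sum_range (fun c => φ (fun m => vertex b m + stepVec N c))]
      have h := Finset.sum_range_succ' (fun c => φ (fun m => vertex b m + stepVec N c)) N
      rw [Finset.sum_range_succ] at h
      have h0 : φ (fun m => vertex b m + stepVec N 0)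
          = φ (vertex b) + changeProd u k (vertex b) := by
        have : changeProd u k (fun m => vertex b m + 1) = changeProd u k (vertex b) := by
          refine Finset.prod_congr rfl fun m _ => ?_
          rw [hu, hu, add_add_add_comm, CharTwo.add_self_eq_zero, add_zero]
        simp only [hφ, stepVec_zero, hu, this]
        ring
      have hN : φ (fun m => vertex b m + stepVec N N) = φ (vertex b) := by
        simp only [stepVec_self, add_zero]
      rw [h0, hN] at h
      have h2 := CharTwo.add_self_eq_zero
        (∑ c ∈ Finset.range N, φ (fun m => vertex b m + stepVec N (c + 1)))
      linear_combination h + h2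
    calc ∑ a : Fin (k + 1) → Fin N, changeProd u (k + 1) (vertex a)
        = ∑ j ∈ Finset.range (k + 2), ∑ a : Fin (k + 1) → Fin N,
            φ (fun m => vertex a (skip j m)) := by
          rw [Finset.sum_comm]
          exact Finset.sum_congr rfl fun a _ => changeProd_succ_eq_sum u k (vertex a)
      _ = 1 := by
          rw [Finset.sum_range_succ, Finset.sum_range_succ', Finset.sum_eq_zero hmid, zero_add,
            hfirst, hlast, ← Finset.sum_add_distrib, Finset.sum_congr rfl fun b _ => htel b, ih]

theorem exists_changes (N : ℕ) (u : ℕ → (Fin N → ZMod 2) → ZMod 2)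
    (hu : ∀ m v, u m (v + 1) = u m v + 1) (k : ℕ) :
    ∃ a : Fin k → Fin N, ∀ m < k, u m (vertex a m) ≠ u m (vertex a (m + 1)) := by
  by_contra! h
  have := sum_changeProd_vertex N u hu k
  rw [Finset.sum_eq_zero] at this
  · exact zero_ne_one this
  · intro a _
    obtain ⟨m, hm, he⟩ := h a
    refine Finset.prod_eq_zero (Finset.mem_range.2 hm) ?_
    rw [he]
    exact CharTwo.add_self_eq_zero _

/-! ### Balancing `k` functions with `k` cuts of an interval -/

/-- The real sign of an element of `ZMod 2`. -/
def realSign (z : ZMod 2) : ℝ := if z = 0 then 1 else -1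

theorem realSign_add_one (z : ZMod 2) : realSign (z + 1) = -realSign z := by
  unfold realSign
  have h : z = 0 ∨ z = 1 := by
    revert z
    decide
  rcases h with rfl | rfl
  · simp
  · simp [CharTwo.add_self_eq_zero]

theorem realSign_natCast (m : ℕ) : realSign m = (-1) ^ m := by
  induction m with
  | zero => simp [realSign]
  | succ m ih => rw [Nat.cast_succ, realSign_add_one, ih, pow_succ]; ring

theorem one_sub_two_mul_alternating_sum (m : ℕ) :
    (1 : ℝ) - 2 * ∑ i ∈ Finset.range m, (-1) ^ i = (-1) ^ m := by
  induction m with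
  | zero => simp
  | succ m ih => rw [Finset.sum_range_succ, mul_add, ← sub_sub, ih, pow_succ]; ring

theorem exists_forall_iff_lt {k : ℕ} (p : Fin k → Prop) (hp : ∀ i j, i ≤ j → p j → p i) :
    ∃ m ≤ k, ∀ i : Fin k, p i ↔ (i : ℕ) < m := by
  classical
  by_cases h : ∃ m, ∃ hm : m < k, ¬ p ⟨m, hm⟩
  · refine ⟨Nat.find h, (Nat.find_spec h).1.le, fun i => ⟨fun hi => ?_, fun hi => ?_⟩⟩
    · by_contra hle
      obtain ⟨hm, hn⟩ := Nat.find_spec h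
      exact hn (hp _ i (not_lt.1 hle) hi)
    · by_contra hn
      exact Nat.find_min h hi ⟨i.2, hn⟩
  · push Not at h
    exact ⟨k, le_rfl, fun i => ⟨fun _ => i.2, fun _ => h i i.2⟩⟩

theorem sum_fin_ite_lt {M : Type*} [AddCommMonoid M] {k m : ℕ} (hm : m ≤ k) (f : ℕ → M) :
    ∑ i : Fin k, (if (i : ℕ) < m then f i else 0) = ∑ i ∈ Finset.range m, f i := by
  rw [Fin.sum_univ_eq_sum_range (fun i => if i < m then f i else 0), ← Finset.sum_filter]
  congr 1
  ext i
  simp only [Finset.mem_filter, Finset.mem_range]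
  omega

/-- Since `p` holds on an initial segment, the sign of its length is an alternating sum. This makes
the sign linear in the indicators, so that it can be summed or integrated. -/
theorem realSign_sum_ite {k : ℕ} (p : Fin k → Prop) [DecidablePred p]
    (hp : ∀ i j, i ≤ j → p j → p i) :
    realSign (∑ i, if p i then 1 else 0)
      = 1 - 2 * ∑ i : Fin k, (if p i then (-1) ^ (i : ℕ) else 0) := by
  obtain ⟨m, hm, h⟩ := exists_forall_iff_lt p hp
  simp only [h]
  rw [sum_fin_ite_lt hm (fun i => (-1 : ℝ) ^ i), one_sub_two_mul_alternating_sum,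
    sum_fin_ite_lt hm (fun _ => (1 : ZMod 2))]
  simp [realSign_natCast]

theorem sum_fin_ite_le_sub {N b : ℕ} (hb : b ≤ N) (G : ℕ → ℝ) :
    ∑ c : Fin N, (if b ≤ (c : ℕ) then G (c + 1) - G c else 0) = G N - G b := by
  rw [Fin.sum_univ_eq_sum_range (fun c => if b ≤ c then G (c + 1) - G c else 0)]
  have h := Finset.sum_range_sub (fun c => G (max b c)) N
  simp only [max_eq_right hb, Nat.zero_le, max_eq_left] at h
  rw [← h]
  refine Finset.sum_congr rfl fun c _ => ?_
  by_cases hc : b ≤ c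
  · rw [if_pos hc, max_eq_right hc, max_eq_right (hc.trans c.le_succ)]
  · rw [if_neg hc, max_eq_left (by omega), max_eq_left (by omega), sub_self]

/-- The imbalance of the increments of `G` with respect to a sign vector. -/
def imbalance {N : ℕ} (G : ℕ → ℝ) (v : Fin N → ZMod 2) : ℝ :=
  ∑ c : Fin N, realSign (v c) * (G (c + 1) - G c)

theorem imbalance_add_one {N : ℕ} (G : ℕ → ℝ) (v : Fin N → ZMod 2) :
    imbalance G (v + 1) = -imbalance G v := by
  simp [imbalance, realSign_add_one, Finset.sum_neg_distrib]

theorem abs_imbalance_add_single_sub_le {N : ℕ} (G : ℕ → ℝ) (v : Fin N → ZMod 2) (c : Fin N) :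
    |imbalance G (v + Pi.single c 1) - imbalance G v| ≤ 2 * |G (c + 1) - G c| := by
  unfold imbalance
  rw [← Finset.sum_sub_distrib, Finset.sum_eq_single c]
  · simp only [Pi.add_apply, Pi.single_eq_same, realSign_add_one]
    rw [← sub_mul, abs_mul]
    refine mul_le_mul_of_nonneg_right ?_ (abs_nonneg _)
    unfold realSign
    split_ifs <;> norm_num
  · intro x _ hx
    simp [Pi.single_eq_of_ne hx]
  · simp

/-- The imbalance of `F` for the cuts `x` of the interval `[α, β]`. -/
def cutImbalance {k : ℕ} (F : ℝ → ℝ) (α β : ℝ) (x : Fin k → ℝ) : ℝ :=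
  (F β - F α) - 2 * ∑ i : Fin k, (-1) ^ (i : ℕ) * (F β - F (x i))

/-- For sorted cuts, the sign of a cell is linear in the indicators of the cuts before it, and each
indicator telescopes the increments of `G`. The result has the form of `cutImbalance`, which makes
sense for real cuts. -/
theorem imbalance_vertex_zero {N k : ℕ} (G : ℕ → ℝ) (b : Fin k → Fin N) (hb : Monotone b) :
    imbalance G (vertex b 0)
      = (G N - G 0) - 2 * ∑ i : Fin k, (-1) ^ (i : ℕ) * (G N - G (b i)) := by
  have h : ∀ c : Fin N, realSign (vertex b 0 c)
      = 1 - 2 * ∑ i : Fin k, (if (b i : ℕ) ≤ c then (-1) ^ (i : ℕ) else 0) := by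
    intro c
    rw [← realSign_sum_ite (fun i => (b i : ℕ) ≤ c)
      fun i j hij hj => le_trans (Fin.val_le_of_le (hb hij)) hj]
    congr 1
    simp [vertex, stepVec]
  have h2 := sum_fin_ite_le_sub (Nat.zero_le N) G
  simp only [Nat.zero_le, if_true] at h2
  simp only [imbalance, h, sub_mul, Finset.sum_sub_distrib, one_mul, h2, mul_assoc,
    ← Finset.mul_sum]
  congr 2
  simp only [Finset.sum_mul]
  rw [Finset.sum_comm]
  refine Finset.sum_congr rfl fun i _ => ?_
  rw [← sum_fin_ite_le_sub (b i).2.le G, Finset.mul_sum]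
  exact Finset.sum_congr rfl fun c _ => by split_ifs <;> simp

/-- The sign of the imbalance, with ties broken by a fixed coordinate. -/
def imbalanceSign {N : ℕ} (c₀ : Fin N) (G : ℕ → ℝ) (v : Fin N → ZMod 2) : ZMod 2 :=
  if imbalance G v < 0 then 1 else if 0 < imbalance G v then 0 else v c₀

theorem imbalanceSign_add_one {N : ℕ} (c₀ : Fin N) (G : ℕ → ℝ) (v : Fin N → ZMod 2) :
    imbalanceSign c₀ G (v + 1) = imbalanceSign c₀ G v + 1 := by
  unfold imbalanceSign
  rw [imbalance_add_one]
  rcases lt_trichotomy (imbalance G v) 0 with h | h | h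
  · simp [h, not_lt.2 h.le, CharTwo.add_self_eq_zero]
  · simp [h]
  · simp [h, not_lt.2 h.le]

/-- A change of sign means that zero lies weakly between the two imbalances, or that the first is
zero by a tie. -/
theorem abs_imbalance_le_of_imbalanceSign_ne {N : ℕ} (c₀ : Fin N) (G : ℕ → ℝ)
    (v w : Fin N → ZMod 2)
    (h : imbalanceSign c₀ G v ≠ imbalanceSign c₀ G w) :
    |imbalance G v| ≤ |imbalance G w - imbalance G v| := by
  unfold imbalanceSign at h
  rcases lt_trichotomy (imbalance G v) 0 with hv | hv | hv
  · have hw : 0 ≤ imbalance G w := by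
      by_contra hw
      simp [hv, not_le.1 hw] at h
    rw [abs_of_neg hv, abs_of_nonneg (by linarith)]
    linarith
  · rw [hv]
    simp
  · have hw : imbalance G w ≤ 0 := by
      by_contra hw
      simp [hv, not_le.1 hw, not_lt.2 hv.le, not_lt.2 (not_le.1 hw).le] at h
    rw [abs_of_pos hv, abs_of_nonpos (by linarith)]
    linarith

theorem vertex_zero_comp_perm {N k : ℕ} (a : Fin k → Fin N) (e : Equiv.Perm (Fin k)) :
    vertex (a ∘ e) 0 = vertex a 0 := by
  simpa [vertex] using Equiv.sum_comp e fun i => stepVec N (a i)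

/-- Along the walk of `exists_changes` each move alters an imbalance by at most `2 * ε`. The `m`-th
imbalance crosses zero at the `m`-th move, so at the start it is at most `2 * ε * (m + 1)`. The
starting vertex does not depend on the order of the cuts, so they may be sorted. -/
theorem exists_monotone_abs_imbalance_le {N k : ℕ} (hN : 0 < N) (G : ℕ → ℕ → ℝ) {ε : ℝ}
    (hG : ∀ m < k, ∀ c < N, |G m (c + 1) - G m c| ≤ ε) :
    ∃ b : Fin k → Fin N, Monotone b ∧
      ∀ m < k, |imbalance (G m) (vertex b 0)| ≤ 2 * (k + 1) * ε := by
  obtain ⟨a, ha⟩ := exists_changes N (fun m => imbalanceSign ⟨0, hN⟩ (G m))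
    (fun m v => imbalanceSign_add_one _ _ v) k
  refine ⟨a ∘ Tuple.sort a, Tuple.monotone_sort a, fun m hm => ?_⟩
  rw [vertex_zero_comp_perm]
  have hstep : ∀ i < k, |imbalance (G m) (vertex a (i + 1)) - imbalance (G m) (vertex a i)|
      ≤ 2 * ε := by
    intro i hi
    have := vertex_succ a ⟨i, hi⟩
    simp only at this
    rw [this]
    exact (abs_imbalance_add_single_sub_le _ _ _).trans
      (mul_le_mul_of_nonneg_left (hG m hm _ (a _).2) zero_le_two)
  have hwalk : ∀ i ≤ k, |imbalance (G m) (vertex a i) - imbalance (G m) (vertex a 0)|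
      ≤ 2 * ε * i := by
    intro i
    induction i with
    | zero => simp
    | succ i ih =>
      intro hi
      have h1 := ih (by omega)
      have h2 := hstep i (by omega)
      have h3 := abs_sub_le (imbalance (G m) (vertex a (i + 1))) (imbalance (G m) (vertex a i))
        (imbalance (G m) (vertex a 0))
      push_cast
      linarith
  have h1 := abs_imbalance_le_of_imbalanceSign_ne _ _ _ _ (ha m hm)
  have h2 := hstep m hm
  have h3 := hwalk m hm.le
  have h4 := abs_sub_abs_le_abs_sub (imbalance (G m) (vertex a 0)) (imbalance (G m) (vertex a m))
  rw [abs_sub_comm] at h4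
  have hε : 0 ≤ ε := (abs_nonneg _).trans (hG m hm 0 hN)
  have h5 : 2 * ε * (m : ℝ) ≤ 2 * ε * k :=
    mul_le_mul_of_nonneg_left (Nat.cast_le.2 hm.le) (by linarith)
  linarith

/-- **Hobby–Rice theorem**, for Lipschitz primitives: `k` functions on an interval can be balanced
with `k` cuts. -/
theorem exists_cutImbalance_eq_zero {k : ℕ} (F : ℕ → ℝ → ℝ) {α β K : ℝ} (hαβ : α ≤ β)
    (hF : ∀ m < k, ∀ s t, |F m s - F m t| ≤ K * |s - t|) :
    ∃ x : Fin k → ℝ, Monotone x ∧ (∀ i, x i ∈ Set.Icc α β) ∧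
      ∀ m < k, cutImbalance (F m) α β x = 0 := by
  have hcont : ∀ m < k, Continuous (F m) := by
    intro m hm
    refine LipschitzWith.continuous (K := K.toNNReal) (LipschitzWith.of_dist_le_mul ?_)
    intro s t
    rw [Real.dist_eq, Real.dist_eq]
    exact (hF m hm s t).trans
      (mul_le_mul_of_nonneg_right (Real.le_coe_toNNReal K) (abs_nonneg _))
  -- The total imbalance attains its minimum on this compact set; the grid approximations force that
  -- minimum to be zero.
  set S : Set (Fin k → ℝ) := {x | Monotone x} ∩ Set.Icc (fun _ => α) (fun _ => β) with hS
  have hcpt : IsCompact S := isCompact_Icc.inter_left isClosed_monotone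
  have hne : S.Nonempty :=
    ⟨fun _ => α, monotone_const, fun _ => le_rfl, fun _ => hαβ⟩
  have hΨ : Continuous fun x : Fin k → ℝ =>
      ∑ m ∈ Finset.range k, |cutImbalance (F m) α β x| := by
    refine continuous_finsetSum _ fun m hm => ?_
    have := hcont m (Finset.mem_range.1 hm)
    unfold cutImbalance
    fun_prop
  obtain ⟨x, hx, hmin⟩ := hcpt.exists_isMinOn hne hΨ.continuousOn
  refine ⟨x, hx.1, fun i => ⟨hx.2.1 i, hx.2.2 i⟩, ?_⟩
  rcases Nat.eq_zero_or_pos k with hk | hk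
  · intro m hm
    omega
  have hK : 0 ≤ K := by
    have := hF 0 hk 1 0
    simp only [sub_zero, abs_one, mul_one] at this
    exact (abs_nonneg _).trans this
  -- With `n + 1` equal grid cells the increments are at most `K * (β - α) / (n + 1)`, and the
  -- discrete solution is a competitor in `S`.
  have happrox : ∀ n : ℕ, ∑ m ∈ Finset.range k, |cutImbalance (F m) α β x|
      ≤ (k * (2 * (k + 1) * (K * (β - α)))) / ((n : ℝ) + 1) := by
    intro n
    set g : ℕ → ℝ := fun c => α + c * ((β - α) / ((n : ℝ) + 1)) with hg
    have hn : (0 : ℝ) < (n : ℝ) + 1 := by positivity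
    have hq : 0 ≤ (β - α) / ((n : ℝ) + 1) := div_nonneg (by linarith) hn.le
    have hgmono : Monotone g := fun c c' hcc =>
      add_le_add_right (mul_le_mul_of_nonneg_right (Nat.cast_le.2 hcc) hq) _
    have hg0 : g 0 = α := by simp [hg]
    have hgN : g (n + 1) = β := by
      simp only [hg]
      push_cast
      field_simp
      ring
    obtain ⟨b, hb, hbal⟩ := exists_monotone_abs_imbalance_le (k := k) (Nat.succ_pos n)
      (fun m c => F m (g c)) (ε := K * ((β - α) / ((n : ℝ) + 1))) (by
        intro m hm c _
        refine (hF m hm _ _).trans (mul_le_mul_of_nonneg_left ?_ hK)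
        have : g (c + 1) - g c = (β - α) / ((n : ℝ) + 1) := by
          simp only [hg]
          push_cast
          ring
        rw [this, abs_of_nonneg hq])
    have hy : (fun i => g (b i)) ∈ S := by
      refine ⟨fun i j hij => hgmono (hb hij), fun i => ?_, fun i => ?_⟩
      · exact hg0 ▸ hgmono (Nat.zero_le _)
      · exact hgN ▸ hgmono (b i).2.le
    refine (hmin hy).trans ?_
    refine (Finset.sum_le_card_nsmul _ _ (2 * (k + 1) * (K * ((β - α) / ((n : ℝ) + 1)))) ?_).trans
      (le_of_eq ?_)
    · intro m hm
      have := hbal m (Finset.mem_range.1 hm)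
      rw [imbalance_vertex_zero _ b hb, hgN, hg0] at this
      exact this
    · rw [Finset.card_range, nsmul_eq_mul]
      ring
  have hlim : Filter.Tendsto
      (fun n : ℕ => (k * (2 * (k + 1) * (K * (β - α)))) / ((n : ℝ) + 1)) Filter.atTop (nhds 0) :=
    tendsto_const_nhds.div_atTop
      (Filter.tendsto_atTop_add_const_right _ _ tendsto_natCast_atTop_atTop)
  have hle := ge_of_tendsto' hlim happrox
  have h0 := le_antisymm hle (Finset.sum_nonneg fun m _ => abs_nonneg _)
  intro m hm
  exact abs_eq_zero.1 ((Finset.sum_eq_zero_iff_of_nonneg fun m _ => abs_nonneg _).1 h0 m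
    (Finset.mem_range.2 hm))

/-! ### Cubes, slabs and the pieces of a splitting -/

theorem volume_hyperplane {d : ℕ} (i : Fin d) (a : ℝ) :
    volume {x : Fin d → ℝ | x i = a} = 0 := by
  rw [volume_pi]
  exact Measure.pi_hyperplane (fun _ : Fin d => (volume : Measure ℝ)) i a

theorem Necklace.volume_toSet {d : ℕ} (C : Necklace d) :
    volume C.toSet = ENNReal.ofReal (C.side ^ d) := by
  rw [Necklace.toSet, Real.volume_Icc_pi]
  simp [ENNReal.ofReal_pow C.side_pos.le]

theorem Necklace.volume_ne_top {d : ℕ} (C : Necklace d) {A : Set (Fin d → ℝ)}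
    (hA : A ⊆ C.toSet) : volume A ≠ ⊤ :=
  ((measure_mono hA).trans_lt isCompact_Icc.measure_lt_top).ne

theorem Necklace.volume_real_slab_le {d : ℕ} (C : Necklace d) (i : Fin d) (a b : ℝ) :
    volume.real {x ∈ C.toSet | x i ∈ Set.uIcc a b} ≤ C.side ^ (d - 1) * |a - b| := by
  have hsub : {x ∈ C.toSet | x i ∈ Set.uIcc a b} ⊆
      Set.univ.pi fun j => if j = i then Set.uIcc a b
        else Set.Icc (C.corner j) (C.corner j + C.side) := by
    rintro x ⟨hx, hxi⟩ j -
    dsimp only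
    split_ifs with h
    · exact h ▸ hxi
    · exact ⟨hx.1 j, hx.2 j⟩
  have hvol : volume (Set.univ.pi fun j => if j = i then Set.uIcc a b
        else Set.Icc (C.corner j) (C.corner j + C.side))
      = ENNReal.ofReal (C.side ^ (d - 1) * |a - b|) := by
    rw [volume_pi_pi, ← Finset.mul_prod_erase _ _ (Finset.mem_univ i)]
    have : ∀ j ∈ Finset.univ.erase i, volume (if j = i then Set.uIcc a b
        else Set.Icc (C.corner j) (C.corner j + C.side)) = ENNReal.ofReal C.side := by
      intro j hj
      rw [if_neg (Finset.ne_of_mem_erase hj)]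
      simp
    rw [Finset.prod_congr rfl this, if_pos rfl, Finset.prod_const,
      Finset.card_erase_of_mem (Finset.mem_univ i), Finset.card_univ, Fintype.card_fin,
      Real.volume_interval, ← ENNReal.ofReal_pow C.side_pos.le,
      ← ENNReal.ofReal_mul (abs_nonneg _), abs_sub_comm, mul_comm]
  rw [measureReal_def]
  refine ENNReal.toReal_le_of_le_ofReal
    (mul_nonneg (pow_nonneg C.side_pos.le _) (abs_nonneg _)) ?_
  exact hvol ▸ measure_mono hsub

/-- Sets in a cube that are determined by finitely many coordinate comparisons have a volume that
is Lipschitz in the thresholds. -/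
theorem Necklace.abs_volume_real_sub_le {d : ℕ} (C : Necklace d) {ι : Type*} [Fintype ι]
    (dir : ι → Fin d) (p r : ι → ℝ) {A B : Set (Fin d → ℝ)} (hA : A ⊆ C.toSet)
    (hB : B ⊆ C.toSet)
    (h : ∀ x ∈ C.toSet, (∀ σ, p σ < x (dir σ) ↔ r σ < x (dir σ)) → (x ∈ A ↔ x ∈ B)) :
    |volume.real A - volume.real B| ≤ ∑ σ, C.side ^ (d - 1) * |p σ - r σ| := by
  -- Outside the slabs between corresponding thresholds all comparisons agree, so `A` and `B` differ
  -- only inside `U`.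
  set U : Set (Fin d → ℝ) := ⋃ σ, {x ∈ C.toSet | x (dir σ) ∈ Set.uIcc (p σ) (r σ)} with hU
  have hUC : U ⊆ C.toSet := Set.iUnion_subset fun σ x hx => hx.1
  have hUle : volume.real U ≤ ∑ σ, C.side ^ (d - 1) * |p σ - r σ| :=
    (measureReal_iUnion_fintype_le _).trans
      (Finset.sum_le_sum fun σ _ => C.volume_real_slab_le _ _ _)
  have key : ∀ x ∈ C.toSet, x ∉ U → (x ∈ A ↔ x ∈ B) := by
    intro x hx hxU
    refine h x hx fun σ => ?_
    by_contra hne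
    refine hxU (Set.mem_iUnion.2 ⟨σ, hx, ?_⟩)
    rw [Set.mem_uIcc]
    by_cases h1 : p σ < x (dir σ)
    · have h2 : ¬ r σ < x (dir σ) := fun h2 => hne ⟨fun _ => h2, fun _ => h1⟩
      exact Or.inl ⟨h1.le, not_lt.1 h2⟩
    · have h2 : r σ < x (dir σ) := by
        by_contra h2
        exact hne ⟨fun h => absurd h h1, fun h => absurd h h2⟩
      exact Or.inr ⟨h2.le, not_lt.1 h1⟩
  have half : ∀ A' B' : Set (Fin d → ℝ), A' ⊆ C.toSet → B' ⊆ C.toSet →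
      (∀ x ∈ C.toSet, x ∉ U → (x ∈ A' ↔ x ∈ B')) →
      volume.real A' ≤ volume.real B' + volume.real U := by
    intro A' B' hA' hB' hk
    refine (measureReal_mono ?_ ?_).trans (measureReal_union_le B' U)
    · intro x hx
      by_cases hxU : x ∈ U
      · exact Or.inr hxU
      · exact Or.inl ((hk x (hA' hx) hxU).1 hx)
    · exact C.volume_ne_top (Set.union_subset hB' hUC)
  have h1 := half A B hA hB key
  have h2 := half B A hB hA fun x hx hxU => (key x hx hxU).symm
  rw [abs_sub_le_iff]
  constructor <;> linarith

/-- The number of cuts in each direction lying strictly before a point. -/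
def cutCount {d : ℕ} {cuts : Fin d → ℕ} (z : (Σ i, Fin (cuts i)) → ℝ) (x : Fin d → ℝ)
    (i : Fin d) : Fin (cuts i + 1) :=
  ⟨(Finset.univ.filter fun m => z ⟨i, m⟩ < x i).card,
    Nat.lt_succ_of_le ((Finset.card_le_univ _).trans (Fintype.card_fin _).le)⟩

theorem measurable_cutCount {d : ℕ} {cuts : Fin d → ℕ} (z : (Σ i, Fin (cuts i)) → ℝ) :
    Measurable (cutCount z) := by
  refine measurable_pi_iff.2 fun i => measurable_to_countable' fun j => ?_
  have hm : Measurable fun x : Fin d → ℝ => ∑ m : Fin (cuts i), if z ⟨i, m⟩ < x i then 1 else 0 :=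
    Finset.measurable_sum _ fun m _ => Measurable.ite
      (measurableSet_lt measurable_const (measurable_pi_apply i)) measurable_const
      measurable_const
  have : (fun x => cutCount z x i) ⁻¹' {j}
      = (fun x : Fin d → ℝ => ∑ m : Fin (cuts i), if z ⟨i, m⟩ < x i then 1 else 0) ⁻¹'
        {(j : ℕ)} := by
    ext x
    simp only [Set.mem_preimage, Set.mem_singleton_iff, Fin.ext_iff, cutCount]
    rw [Finset.card_filter]
  rw [this]
  exact hm (measurableSet_singleton _)

/-- The region of the cube that the cuts `z` and the labels assign to the part `l`. -/
def region {d q : ℕ} (C : Necklace d) {cuts : Fin d → ℕ} (z : (Σ i, Fin (cuts i)) → ℝ)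
    (label : ((i : Fin d) → Fin (cuts i + 1)) → Fin q) (l : Fin q) : Set (Fin d → ℝ) :=
  {x ∈ C.toSet | label (cutCount z x) = l}

theorem measurableSet_region {d q : ℕ} (C : Necklace d) {cuts : Fin d → ℕ}
    (z : (Σ i, Fin (cuts i)) → ℝ)
    (label : ((i : Fin d) → Fin (cuts i + 1)) → Fin q) (l : Fin q) :
    MeasurableSet (region C z label l) :=
  measurableSet_Icc.inter
    ((measurable_cutCount z) (DiscreteMeasurableSpace.forall_measurableSet (label ⁻¹' {l})))

namespace Splitting

variable {d q : ℕ} {C : Necklace d}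

/-- The positions of the cuts of a splitting. -/
def inner (s : Splitting C q) : (Σ i, Fin (s.cuts i)) → ℝ := fun m => s.pos m.1 m.2.succ.castSucc

theorem inner_lt_iff (s : Splitting C q) {j : (i : Fin d) → Fin (s.cuts i + 1)}
    {x : Fin d → ℝ} (hx : x ∈ s.piece j) (hne : ∀ m, x m.1 ≠ s.inner m) (i : Fin d)
    (m : Fin (s.cuts i)) : s.inner ⟨i, m⟩ < x i ↔ m.castSucc < j i := by
  constructor
  · intro h
    by_contra hj
    refine absurd (h.trans_le (hx.2 i)) (not_lt.2 (s.pos_monotone i ?_))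
    rw [Fin.le_def]
    have := Fin.le_def.1 (not_lt.1 hj)
    simp at this ⊢
    omega
  · intro h
    refine lt_of_le_of_ne (le_trans (s.pos_monotone i ?_) (hx.1 i)) (hne ⟨i, m⟩).symm
    rw [Fin.le_def]
    have := Fin.lt_def.1 h
    simp at this ⊢
    omega

theorem cutCount_eq (s : Splitting C q) {j : (i : Fin d) → Fin (s.cuts i + 1)}
    {x : Fin d → ℝ} (hx : x ∈ s.piece j) (hne : ∀ m, x m.1 ≠ s.inner m) :
    cutCount s.inner x = j := by
  funext i
  refine Fin.ext ?_
  simp only [cutCount, s.inner_lt_iff hx hne, Fin.lt_def, Fin.val_castSucc]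
  have h := sum_fin_ite_lt (Nat.le_of_lt_succ (j i).2) (fun _ => 1)
  rw [Finset.card_filter, h]
  simp

theorem mem_piece_cutCount (s : Splitting C q) {x : Fin d → ℝ} (hx : x ∈ C.toSet) :
    x ∈ s.piece (cutCount s.inner x) := by
  have key : ∀ i, s.pos i (cutCount s.inner x i).castSucc ≤ x i ∧
      x i ≤ s.pos i (cutCount s.inner x i).succ := by
    intro i
    obtain ⟨m, hm, hiff⟩ := exists_forall_iff_lt (fun m => s.inner ⟨i, m⟩ < x i)
      fun a b hab hb => (s.pos_monotone i (by
        rw [Fin.le_def] at hab ⊢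
        simpa using hab)).trans_lt hb
    have hc : (cutCount s.inner x i : ℕ) = m := by
      simp only [cutCount, hiff]
      rw [Finset.card_filter, sum_fin_ite_lt hm fun _ => 1]
      simp
    constructor
    · rcases Nat.eq_zero_or_pos m with h0 | h0
      · have : (cutCount s.inner x i).castSucc = 0 := Fin.ext (by simp [hc, h0])
        rw [this, s.pos_first]
        exact hx.1 i
      · have h := (hiff ⟨m - 1, by omega⟩).2 (by simp only; omega)
        refine le_trans (le_of_eq (congrArg (s.pos i) (Fin.ext ?_))) h.le
        simp [hc]
        omega
    · rcases hm.eq_or_lt with h0 | h0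
      · have : (cutCount s.inner x i).succ = Fin.last (s.cuts i + 1) :=
          Fin.ext (by simp [hc, h0])
        rw [this, s.pos_last]
        exact hx.2 i
      · have h := mt (hiff ⟨m, h0⟩).1 (by simp)
        refine le_trans (not_lt.1 h) (le_of_eq (congrArg (s.pos i) (Fin.ext ?_)))
        simp [hc]
  exact ⟨fun i => (key i).1, fun i => (key i).2⟩

theorem piece_subset (s : Splitting C q) (j : (i : Fin d) → Fin (s.cuts i + 1)) :
    s.piece j ⊆ C.toSet := by
  refine fun x hx => ⟨fun i => ?_, fun i => ?_⟩
  · exact (s.pos_first i).ge.trans ((s.pos_monotone i (Fin.zero_le _)).trans (hx.1 i))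
  · exact (hx.2 i).trans ((s.pos_monotone i (Fin.le_last _)).trans (s.pos_last i).le)

theorem ae_ne_inner (s : Splitting C q) :
    ∀ᵐ x : Fin d → ℝ, ∀ m, x m.1 ≠ s.inner m :=
  ae_all_iff.2 fun m => ae_iff.2 (by simpa using volume_hyperplane m.1 (s.inner m))

/-- Off the null cut hyperplanes a point lies in exactly one cuboid, the one indexed by its cut
counts. Overlapping closed parts are thus replaced by disjoint regions. -/
theorem part_ae_eq_region (s : Splitting C q) (l : Fin q) :
    s.part l =ᵐ[volume] region C s.inner s.label l := by
  refine Filter.eventuallyEq_set.2 ?_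
  filter_upwards [s.ae_ne_inner] with x hx
  simp only [part, region, Set.mem_iUnion, Set.mem_ofPred_eq, exists_prop]
  constructor
  · rintro ⟨j, hj, hxj⟩
    refine ⟨s.piece_subset j hxj, ?_⟩
    rw [s.cutCount_eq hxj hx]
    exact hj
  · rintro ⟨hxC, hl⟩
    exact ⟨_, hl, s.mem_piece_cutCount hxC⟩

theorem volume_inter_part (s : Splitting C q) (l : Fin q) (A : Set (Fin d → ℝ)) :
    volume (A ∩ s.part l) = volume (A ∩ region C s.inner s.label l) :=
  measure_congr ((Filter.EventuallyEq.refl _ A).inter (s.part_ae_eq_region l))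

end Splitting

theorem Coloring.colorClass_subset {d k : ℕ} {C : Necklace d} (f : Coloring C k) (c : Fin k) :
    f.colorClass c ⊆ C.toSet := by
  rintro _ ⟨x, -, rfl⟩
  exact x.2

/-! ### Fair splittings into two parts -/

/-- The splitting into two alternating parts by the cuts `x` perpendicular to the axis `i₀`. -/
def axisSplitting {d k : ℕ} (C : Necklace d) (i₀ : Fin d) (x : Fin k → ℝ) (hx : Monotone x)
    (hxC : ∀ i, x i ∈ Set.Icc (C.corner i₀) (C.corner i₀ + C.side)) : Splitting C 2 where
  cuts i := if i = i₀ then k else 0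
  -- Index `0` is the lower end of the cube and index `m` is the cut `x (m - 1)`; past the last cut,
  -- and at once on the other axes, the value is the upper end.
  pos i m := if (m : ℕ) = 0 then C.corner i
    else if h : (m : ℕ) - 1 < k ∧ i = i₀ then x ⟨m - 1, h.1⟩ else C.corner i + C.side
  pos_monotone i a b hab := by
    have hab' : (a : ℕ) ≤ b := hab
    have hC := C.side_pos
    dsimp only
    by_cases ha : (a : ℕ) = 0
    · rw [if_pos ha]
      by_cases hb : (b : ℕ) = 0
      · rw [if_pos hb]
      · rw [if_neg hb]
        by_cases h2 : (b : ℕ) - 1 < k ∧ i = i₀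
        · rw [dif_pos h2]
          obtain ⟨-, rfl⟩ := h2
          exact (hxC _).1
        · rw [dif_neg h2]
          linarith
    · rw [if_neg ha, if_neg (show ¬ (b : ℕ) = 0 by omega)]
      by_cases h2 : (b : ℕ) - 1 < k ∧ i = i₀
      · rw [dif_pos h2, dif_pos ⟨by omega, h2.2⟩]
        exact hx (Fin.mk_le_mk.2 (by omega))
      · rw [dif_neg h2]
        by_cases h3 : (a : ℕ) - 1 < k ∧ i = i₀
        · rw [dif_pos h3]
          obtain ⟨-, rfl⟩ := h3
          exact (hxC _).2
        · rw [dif_neg h3]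
  pos_first i := by simp
  pos_last i := by
    have : ¬ ((if i = i₀ then k else 0) < k ∧ i = i₀) := by
      rintro ⟨h1, h2⟩
      simp [h2] at h1
    simp [this]
  label j := if Even (j i₀ : ℕ) then 0 else 1

theorem axisSplitting_size {d k : ℕ} (C : Necklace d) (i₀ : Fin d) (x : Fin k → ℝ)
    (hx : Monotone x) (hxC : ∀ i, x i ∈ Set.Icc (C.corner i₀) (C.corner i₀ + C.side)) :
    (axisSplitting C i₀ x hx hxC).size = k := by
  simp [Splitting.size, axisSplitting]

theorem neg_one_pow_cutCount_axisSplitting {d k : ℕ} (C : Necklace d) (i₀ : Fin d)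
    (x : Fin k → ℝ) (hx : Monotone x)
    (hxC : ∀ i, x i ∈ Set.Icc (C.corner i₀) (C.corner i₀ + C.side)) (y : Fin d → ℝ) :
    (-1 : ℝ) ^ (cutCount (axisSplitting C i₀ x hx hxC).inner y i₀ : ℕ)
      = 1 - 2 * ∑ i : Fin k, (if x i < y i₀ then (-1) ^ (i : ℕ) else 0) := by
  obtain ⟨m, hm, hiff⟩ := exists_forall_iff_lt (fun i => x i < y i₀)
    fun a b hab hb => (hx hab).trans_lt hb
  have hcuts : (axisSplitting C i₀ x hx hxC).cuts i₀ = k := by simp [axisSplitting]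
  have hc : (cutCount (axisSplitting C i₀ x hx hxC).inner y i₀ : ℕ) = m := by
    have h : ∀ a : Fin ((axisSplitting C i₀ x hx hxC).cuts i₀),
        (axisSplitting C i₀ x hx hxC).inner ⟨i₀, a⟩ < y i₀ ↔ (a : ℕ) < m := by
      intro a
      have ha : (a : ℕ) < k := a.2.trans_eq hcuts
      have h1 : (axisSplitting C i₀ x hx hxC).inner ⟨i₀, a⟩ = x ⟨a, ha⟩ := by
        change (if (a : ℕ) + 1 = 0 then C.corner i₀
          else if h : (a : ℕ) + 1 - 1 < k ∧ i₀ = i₀ then x ⟨(a : ℕ) + 1 - 1, h.1⟩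
          else C.corner i₀ + C.side) = x ⟨a, ha⟩
        rw [if_neg (Nat.succ_ne_zero _), dif_pos ⟨ha, rfl⟩]
        rfl
      rw [h1]
      exact hiff ⟨a, ha⟩
    simp only [cutCount, h]
    rw [Finset.card_filter, sum_fin_ite_lt (hm.trans_eq hcuts.symm) fun _ => 1]
    simp
  rw [hc, ← one_sub_two_mul_alternating_sum, ← sum_fin_ite_lt hm]
  simp only [hiff]

/-- Integrating the formula for `(-1) ^ cutCount` over `A` turns the difference between the two
parts into `cutImbalance`. As that is zero and the parts exhaust `A`, each takes half. -/
theorem axisSplitting_volume_inter_region {d k : ℕ} (C : Necklace d) (i₀ : Fin d)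
    (x : Fin k → ℝ) (hx : Monotone x)
    (hxC : ∀ i, x i ∈ Set.Icc (C.corner i₀) (C.corner i₀ + C.side))
    {A : Set (Fin d → ℝ)} (hA : NullMeasurableSet A volume) (hAC : A ⊆ C.toSet)
    (hbal : cutImbalance (fun s => volume.real (A ∩ {y | y i₀ ≤ s})) (C.corner i₀)
      (C.corner i₀ + C.side) x = 0) (l : Fin 2) :
    volume (A ∩ region C (axisSplitting C i₀ x hx hxC).inner (axisSplitting C i₀ x hx hxC).label l)
      = volume A / 2 := by
  set s := axisSplitting C i₀ x hx hxC with hs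
  set R : Fin 2 → Set (Fin d → ℝ) := fun l => region C s.inner s.label l with hR
  have hRm : ∀ l, MeasurableSet (R l) := fun l => measurableSet_region _ _ _ _
  set μ : Measure (Fin d → ℝ) := volume.restrict A with hμ
  have hfin : volume A ≠ ⊤ := C.volume_ne_top hAC
  have : IsFiniteMeasure μ := ⟨by simpa [hμ] using hfin.lt_top⟩
  have hmeas : ∀ a : ℝ, MeasurableSet {y : Fin d → ℝ | y i₀ ≤ a} := fun a =>
    measurableSet_le (measurable_pi_apply i₀) measurable_const
  have hmeas' : ∀ a : ℝ, MeasurableSet {y : Fin d → ℝ | a < y i₀} := fun a =>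
    measurableSet_lt measurable_const (measurable_pi_apply i₀)
  have hint : ∀ {B : Set (Fin d → ℝ)}, MeasurableSet B →
      Integrable (B.indicator fun _ => (1 : ℝ)) μ := fun hB =>
    (integrable_const 1).indicator hB
  have hval : ∀ {B : Set (Fin d → ℝ)}, MeasurableSet B →
      ∫ y, B.indicator (fun _ => (1 : ℝ)) y ∂μ = μ.real B := fun hB => by
    rw [integral_indicator_const _ hB, smul_eq_mul, mul_one]
  have hlabel : ∀ y, s.label (cutCount s.inner y)
      = if Even (cutCount s.inner y i₀ : ℕ) then 0 else 1 := fun y => rfl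
  have hind : ∀ y ∈ C.toSet, ∀ l, (R l).indicator (fun _ => (1 : ℝ)) y
      = if (if Even (cutCount s.inner y i₀ : ℕ) then (0 : Fin 2) else 1) = l then 1 else 0 := by
    intro y hy l
    have hmem : y ∈ R l ↔
        (if Even (cutCount s.inner y i₀ : ℕ) then (0 : Fin 2) else 1) = l :=
      ⟨fun h => h.2, fun h => ⟨hy, h⟩⟩
    by_cases h : y ∈ R l
    · rw [Set.indicator_of_mem h, if_pos (hmem.1 h)]
    · rw [Set.indicator_of_notMem h, if_neg fun h' => h (hmem.2 h')]
  have hC : ∀ᵐ y ∂μ, y ∈ C.toSet := (ae_restrict_mem₀ hA).mono fun y hy => hAC hy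
  have hsum : μ.real (R 0) + μ.real (R 1) = μ.real Set.univ := by
    rw [← hval (hRm 0), ← hval (hRm 1), ← integral_add (hint (hRm 0)) (hint (hRm 1)),
      ← hval MeasurableSet.univ]
    refine integral_congr_ae ?_
    filter_upwards [hC] with y hy
    rw [hind y hy, hind y hy]
    by_cases h : Even (cutCount s.inner y i₀ : ℕ) <;> simp [h]
  have hdiff : μ.real (R 0) - μ.real (R 1) = μ.real Set.univ
      - 2 * ∑ i : Fin k, (-1) ^ (i : ℕ) * μ.real {y | x i < y i₀} := by
    have h1 : ∀ i : Fin k, (-1 : ℝ) ^ (i : ℕ) * μ.real {y | x i < y i₀}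
        = ∫ y, (-1) ^ (i : ℕ) * ({y | x i < y i₀}.indicator (fun _ => (1 : ℝ)) y) ∂μ := by
      intro i
      rw [integral_const_mul, hval (hmeas' _)]
    simp only [h1]
    rw [← integral_finsetSum _ fun i _ => (hint (hmeas' _)).const_mul _, ← integral_const_mul,
      ← hval (hRm 0), ← hval (hRm 1), ← integral_sub (hint (hRm 0)) (hint (hRm 1)),
      ← hval MeasurableSet.univ, ← integral_sub (hint MeasurableSet.univ)
        ((integrable_finsetSum _ fun i _ => (hint (hmeas' _)).const_mul _).const_mul _)]
    refine integral_congr_ae ?_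
    filter_upwards [hC] with y hy
    have h2 := neg_one_pow_cutCount_axisSplitting C i₀ x hx hxC y
    have h3 : ∀ i : Fin k, (-1 : ℝ) ^ (i : ℕ) * ({y | x i < y i₀}.indicator (fun _ => (1 : ℝ)) y)
        = if x i < y i₀ then (-1) ^ (i : ℕ) else 0 := by
      intro i
      by_cases h : x i < y i₀ <;> simp [h]
    simp only [h3, Set.indicator_univ]
    rw [hind y hy, hind y hy, ← h2, ← hs]
    by_cases h : Even (cutCount s.inner y i₀ : ℕ)
    · simp [h]
    · simp [h, (Nat.not_even_iff_odd.1 h).neg_one_pow]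
  have hF : ∀ a, volume.real (A ∩ {y | y i₀ ≤ a}) = μ.real {y | y i₀ ≤ a} := fun a => by
    rw [hμ, measureReal_restrict_apply (hmeas a), Set.inter_comm]
  have hFβ : volume.real (A ∩ {y | y i₀ ≤ C.corner i₀ + C.side}) = μ.real Set.univ := by
    rw [hμ, measureReal_restrict_apply MeasurableSet.univ, Set.univ_inter]
    congr 1
    exact Set.inter_eq_left.2 fun y hy => (hAC hy).2 i₀
  have hFα : volume.real (A ∩ {y | y i₀ ≤ C.corner i₀}) = 0 := by
    rw [measureReal_def, measure_mono_null _ (volume_hyperplane i₀ (C.corner i₀)),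
      ENNReal.toReal_zero]
    exact fun y hy => le_antisymm hy.2 ((hAC hy.1).1 i₀)
  have hbal' : μ.real (R 0) = μ.real (R 1) := by
    rw [← sub_eq_zero, hdiff, ← hbal]
    simp only [cutImbalance, hFβ, hFα, sub_zero]
    congr 2
    refine Finset.sum_congr rfl fun i _ => ?_
    rw [hF, ← measureReal_compl (hmeas _)]
    congr 2
    ext y
    simp
  have hhalf : ∀ l, μ.real (R l) = μ.real Set.univ / 2 := by
    intro l
    fin_cases l
    · simp only [Fin.zero_eta]
      linarith
    · simp only [Fin.mk_one]
      linarith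
  have h := hhalf l
  rw [hμ, measureReal_restrict_apply (hRm l), measureReal_restrict_apply MeasurableSet.univ,
    Set.univ_inter, Set.inter_comm, measureReal_def, measureReal_def] at h
  rw [← ENNReal.toReal_eq_toReal_iff' (C.volume_ne_top (Set.inter_subset_left.trans hAC))
    (ENNReal.div_ne_top hfin two_ne_zero), h, ENNReal.toReal_div, ENNReal.toReal_ofNat]

/-- At most `t` colors can be split fairly into two parts with `t` cuts. -/
theorem hasFairSplitting_two {d k t : ℕ} (hd : 1 ≤ d) (hk : k ≤ t) {C : Necklace d}
    (f : Coloring C k) : HasFairSplitting f 2 t := by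
  set i₀ : Fin d := ⟨0, hd⟩
  set A : ℕ → Set (Fin d → ℝ) := fun m => if h : m < k then f.colorClass ⟨m, h⟩ else ∅ with hA
  have hAC : ∀ m, A m ⊆ C.toSet := by
    intro m
    simp only [hA]
    split_ifs with h
    · exact f.colorClass_subset _
    · exact Set.empty_subset _
  obtain ⟨x, hx, hxC, hbal⟩ := exists_cutImbalance_eq_zero (k := k)
    (fun m s => volume.real (A m ∩ {y | y i₀ ≤ s})) (α := C.corner i₀)
    (β := C.corner i₀ + C.side) (K := C.side ^ (d - 1)) (by linarith [C.side_pos]) (by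
      intro m _ s t
      have := C.abs_volume_real_sub_le (fun _ : Unit => i₀) (fun _ => s) (fun _ => t)
        (A := A m ∩ {y | y i₀ ≤ s}) (B := A m ∩ {y | y i₀ ≤ t})
        (Set.inter_subset_left.trans (hAC m)) (Set.inter_subset_left.trans (hAC m)) (by
          intro y _ h
          have := not_congr (h ())
          simp only [not_lt] at this
          simp [this])
      simpa using this)
  refine ⟨axisSplitting C i₀ x hx hxC, (axisSplitting_size C i₀ x hx hxC).le.trans hk, ?_⟩
  intro l c
  rw [Splitting.volume_inter_part]
  refine axisSplitting_volume_inter_region C i₀ x hx hxC (f.measurable c)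
    (f.colorClass_subset c) ?_ l
  have := hbal c c.2
  simp only [hA, dif_pos c.2] at this
  exact this

/-! ### Null sets -/

/-- A measurable set that meets every line through a given point in a null set is null. -/
theorem volume_eq_zero_of_lines {ι : Type*} [Fintype ι] {Z : Set (ι → ℝ)} (hZ : MeasurableSet Z)
    (x₀ : ι → ℝ) (h : ∀ w : ι → ℝ, volume {r : ℝ | x₀ + r • w ∈ Z} = 0) : volume Z = 0 := by
  have hm : MeasurableSet {p : (ι → ℝ) × ℝ | x₀ + p.2 • p.1 ∈ Z} :=
    (show Measurable fun p : (ι → ℝ) × ℝ => x₀ + p.2 • p.1 by fun_prop) hZ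
  have h0 : ((volume : Measure (ι → ℝ)).prod (volume : Measure ℝ))
      {p : (ι → ℝ) × ℝ | x₀ + p.2 • p.1 ∈ Z} = 0 :=
    (Measure.measure_prod_null hm).2 (Filter.Eventually.of_forall h)
  have h1 : ((volume : Measure ℝ).prod (volume : Measure (ι → ℝ)))
      {p : ℝ × (ι → ℝ) | x₀ + p.1 • p.2 ∈ Z} = 0 := by
    have hm' : MeasurableSet {p : ℝ × (ι → ℝ) | x₀ + p.1 • p.2 ∈ Z} :=
      (show Measurable fun p : ℝ × (ι → ℝ) => x₀ + p.1 • p.2 by fun_prop) hZ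
    rw [← Measure.prod_swap, Measure.map_apply measurable_swap hm']
    exact h0
  -- Fubini in the other order: for almost every scale `r` the directions `w` with `x₀ + r • w ∈ Z`
  -- form a null set. One nonzero `r` suffices, because this set is then an affine copy of `Z`.
  have h2 := Measure.measure_ae_null_of_prod_null h1
  have h3 : ∀ᵐ r : ℝ, r ≠ 0 := ae_iff.2 (by simp)
  obtain ⟨r, hr, hr0⟩ := (h2.and h3).exists
  have h4 : volume ((fun w : ι → ℝ => r • w) ⁻¹' ((fun w => x₀ + w) ⁻¹' Z)) = 0 := hr
  rw [Measure.addHaar_preimage_smul _ hr0, measure_preimage_add, mul_eq_zero] at h4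
  refine h4.resolve_left ?_
  simp [hr0]

/-- The zero set of a real polynomial that does not vanish identically is null. -/
theorem volume_zeros_eq_zero {ι : Type*} [Fintype ι] (Q : MvPolynomial ι ℝ) (w₀ : ι → ℝ)
    (hw₀ : MvPolynomial.eval w₀ Q ≠ 0) :
    volume {w : ι → ℝ | MvPolynomial.eval w Q = 0} = 0 := by
  refine volume_eq_zero_of_lines ?_ w₀ fun w => ?_
  · exact (isClosed_eq (MvPolynomial.continuous_eval Q) continuous_const).measurableSet
  -- The restriction of `Q` to the line through `w₀` in direction `w`, nonzero since its value at
  -- `0` is that of `Q` at `w₀`.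
  · set p : Polynomial ℝ := MvPolynomial.aeval
      (fun i => Polynomial.C (w₀ i) + Polynomial.X * Polynomial.C (w i)) Q with hp
    have heval : ∀ r, p.eval r = MvPolynomial.eval (w₀ + r • w) Q := by
      intro r
      rw [hp, ← Polynomial.coe_evalRingHom, MvPolynomial.aeval_def, MvPolynomial.hom_eval₂,
        MvPolynomial.eval, MvPolynomial.coe_eval₂Hom]
      congr 1
      · ext a
        simp
      · ext i
        simp
        exact mul_comm _ _
    have hp0 : p ≠ 0 := by
      intro h0
      apply hw₀
      have := heval 0
      simpa [h0] using this.symm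
    refine ((p.finite_setOfPred_isRoot hp0).subset fun r hr => ?_).measure_zero _
    exact (heval r).trans hr

/-- The image of a null set under a Lipschitz map between spaces of the same dimension is null. -/
theorem volume_image_eq_zero_of_lipschitz {ι : Type*} [Fintype ι] {Φ : (ι → ℝ) → ι → ℝ}
    {K : NNReal} (hΦ : LipschitzWith K Φ) {S : Set (ι → ℝ)} (hS : volume S = 0) :
    volume (Φ '' S) = 0 := by
  rw [← hausdorffMeasure_pi_real] at hS ⊢
  have := hΦ.hausdorffMeasure_image_le (d := Fintype.card ι) (Nat.cast_nonneg _) S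
  rwa [hS, mul_zero, nonpos_iff_eq_zero] at this

/-! ### The volume of a part as a polynomial in the positions of the cuts -/

namespace Splitting

variable {d q : ℕ} {C : Necklace d}

theorem volume_real_piece (s : Splitting C q) (j : (i : Fin d) → Fin (s.cuts i + 1)) :
    volume.real (s.piece j) = ∏ i, (s.pos i (j i).succ - s.pos i (j i).castSucc) := by
  rw [measureReal_def, piece, Real.volume_Icc_pi_toReal]
  exact fun i => s.pos_monotone i (Fin.castSucc_lt_succ).le

theorem volume_real_region (s : Splitting C q) (l : Fin q) :
    volume.real (region C s.inner s.label l)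
      = ∑ j, if s.label j = l then volume.real (s.piece j) else 0 := by
  have hpart : s.part l = ⋃ j ∈ Finset.univ.filter fun j => s.label j = l, s.piece j := by
    simp [part]
  rw [← measureReal_congr (s.part_ae_eq_region l), measureReal_def, hpart,
    measure_biUnion_finset₀, ENNReal.toReal_sum, Finset.sum_filter]
  · rfl
  · exact fun j _ => C.volume_ne_top (s.piece_subset j)
  · intro j _ j' _ hne
    refine measure_eq_zero_iff_ae_notMem.2 ?_
    filter_upwards [s.ae_ne_inner] with x hx hmem
    exact hne ((s.cutCount_eq hmem.1 hx).symm.trans (s.cutCount_eq hmem.2 hx))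
  · exact fun j _ => measurableSet_Icc.nullMeasurableSet

end Splitting

/-- The positions of the cuts, as polynomials in variables indexed by `e`. -/
def posPoly {d : ℕ} (C : Necklace d) {cuts : Fin d → ℕ} {ι : Type*}
    (e : (Σ i, Fin (cuts i)) → ι) (i : Fin d) (m : Fin (cuts i + 2)) : MvPolynomial ι ℝ :=
  if (m : ℕ) = 0 then MvPolynomial.C (C.corner i)
  else if h : (m : ℕ) - 1 < cuts i then MvPolynomial.X (e ⟨i, ⟨m - 1, h⟩⟩)
  else MvPolynomial.C (C.corner i + C.side)

/-- The volume of the part `l`, as a polynomial in the positions of the cuts. -/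
def partPoly {d q : ℕ} (C : Necklace d) {cuts : Fin d → ℕ} {ι : Type*}
    (e : (Σ i, Fin (cuts i)) → ι) (label : ((i : Fin d) → Fin (cuts i + 1)) → Fin q)
    (l : Fin q) : MvPolynomial ι ℝ :=
  ∑ j, if label j = l then ∏ i, (posPoly C e i (j i).succ - posPoly C e i (j i).castSucc) else 0

theorem eval_posPoly {d q : ℕ} {C : Necklace d} (s : Splitting C q) {ι : Type*}
    (e : (Σ i, Fin (s.cuts i)) → ι) (w : ι → ℝ) (hw : ∀ m, w (e m) = s.inner m) (i : Fin d)
    (m : Fin (s.cuts i + 2)) : MvPolynomial.eval w (posPoly C e i m) = s.pos i m := by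
  unfold posPoly
  split_ifs with h0 h1
  · rw [MvPolynomial.eval_C, show m = 0 from Fin.ext h0, s.pos_first]
  · rw [MvPolynomial.eval_X, hw]
    refine congrArg (s.pos i) (Fin.ext ?_)
    simp only [Fin.val_castSucc, Fin.val_succ]
    omega
  · rw [MvPolynomial.eval_C, ← s.pos_last]
    refine congrArg (s.pos i) (Fin.ext ?_)
    rw [Fin.val_last]
    omega

theorem eval_partPoly {d q : ℕ} {C : Necklace d} (s : Splitting C q) {ι : Type*}
    (e : (Σ i, Fin (s.cuts i)) → ι) (w : ι → ℝ) (hw : ∀ m, w (e m) = s.inner m) (l : Fin q) :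
    MvPolynomial.eval w (partPoly C e s.label l)
      = volume.real (region C s.inner s.label l) := by
  simp only [s.volume_real_region, partPoly, map_sum, apply_ite (MvPolynomial.eval w), map_prod,
    map_sub, eval_posPoly s e w hw, map_zero, s.volume_real_piece]

/-- With all cuts pushed to the lower faces, only the last cuboid is nondegenerate, and it is the
whole cube. So the part has all the volume or none. -/
theorem eval_partPoly_corner {d q : ℕ} (C : Necklace d) {cuts : Fin d → ℕ} {ι : Type*}
    (e : (Σ i, Fin (cuts i)) → ι) (label : ((i : Fin d) → Fin (cuts i + 1)) → Fin q)
    (l : Fin q) (w : ι → ℝ) (hw : ∀ m, w (e m) = C.corner m.1) :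
    MvPolynomial.eval w (partPoly C e label l)
      = if label (fun i => Fin.last (cuts i)) = l then C.side ^ d else 0 := by
  have hpos : ∀ i (m : Fin (cuts i + 2)), MvPolynomial.eval w (posPoly C e i m)
      = if (m : ℕ) = cuts i + 1 then C.corner i + C.side else C.corner i := by
    intro i m
    have := m.2
    unfold posPoly
    by_cases h0 : (m : ℕ) = 0
    · rw [if_pos h0, if_neg (by omega), MvPolynomial.eval_C]
    · rw [if_neg h0]
      by_cases h1 : (m : ℕ) - 1 < cuts i
      · rw [dif_pos h1, if_neg (by omega), MvPolynomial.eval_X, hw]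
      · rw [dif_neg h1, if_pos (by omega), MvPolynomial.eval_C]
  have hfac : ∀ i (j : Fin (cuts i + 1)), MvPolynomial.eval w (posPoly C e i j.succ)
      - MvPolynomial.eval w (posPoly C e i j.castSucc)
      = if j = Fin.last (cuts i) then C.side else 0 := by
    intro i j
    have := j.2
    rw [hpos, hpos, Fin.val_succ, Fin.val_castSucc, if_neg (show ¬ (j : ℕ) = cuts i + 1 by omega)]
    by_cases h : j = Fin.last (cuts i)
    · subst h
      simp
    · have h' : (j : ℕ) ≠ cuts i := fun h' => h (Fin.ext h')
      rw [if_neg h, if_neg (by omega), sub_self]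
  simp only [partPoly, map_sum, apply_ite (MvPolynomial.eval w), map_prod, map_sub, hfac, map_zero]
  rw [Finset.sum_eq_single fun i => Fin.last (cuts i)]
  · simp
  · intro j _ hj
    obtain ⟨i, hi⟩ := Function.ne_iff.1 hj
    rw [Finset.prod_eq_zero (Finset.mem_univ i) (if_neg hi), ite_self]
  · simp

/-- Almost no positions of the cuts give the part `l` the volume of a `q`-th of the cube. -/
theorem volume_partPoly_eq_zero {d q : ℕ} (hq : 2 ≤ q) (C : Necklace d) {cuts : Fin d → ℕ}
    {ι : Type*} [Fintype ι] (e : (Σ i, Fin (cuts i)) → ι) (he : Function.Injective e)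
    (label : ((i : Fin d) → Fin (cuts i + 1)) → Fin q) (l : Fin q) :
    volume {w : ι → ℝ | MvPolynomial.eval w (partPoly C e label l) = C.side ^ d / q} = 0 := by
  -- At this point the part has volume `C.side ^ d` or `0`; neither is a `q`-th of the cube because
  -- `q ≥ 2`.
  have h := volume_zeros_eq_zero (partPoly C e label l - MvPolynomial.C (C.side ^ d / q))
    (Function.extend e (fun m => C.corner m.1) 0) ?_
  · simpa [sub_eq_zero] using h
  · rw [map_sub, MvPolynomial.eval_C, eval_partPoly_corner C e label l _
      fun m => he.extend_apply _ _ m]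
    have hq' : (2 : ℝ) ≤ q := by exact_mod_cast hq
    have hL : 0 < C.side ^ d := pow_pos C.side_pos d
    have h1 : 0 < C.side ^ d / q := by positivity
    have h2 : C.side ^ d / q < C.side ^ d := div_lt_self hL (by linarith)
    split_ifs
    · exact (sub_pos.2 h2).ne'
    · rw [zero_sub]
      exact (neg_neg_of_pos h1).ne

/-! ### Recoloring small boxes -/

/-- The lower corner of the box of color `σ.2` in the cell `σ.1` of the `N × ⋯ × N` grid. -/
def boxCorner {d k N : ℕ} (C : Necklace d) (σ : (Fin d → Fin N) × Fin k) (i : Fin d) : ℝ :=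
  C.corner i + C.side / (N * k) * ((k * (σ.1 i : ℕ) + (σ.2 : ℕ) : ℕ) : ℝ)

/-- The half-open box with side `h` at `boxCorner C σ`. -/
def box {d k N : ℕ} (C : Necklace d) (h : ℝ) (σ : (Fin d → Fin N) × Fin k) : Set (Fin d → ℝ) :=
  {x | ∀ i, x i ∈ Set.Ico (boxCorner C σ i) (boxCorner C σ i + h)}

/-- The part of a box below the threshold `r` in direction `i₀`. -/
def spot {d k N : ℕ} (C : Necklace d) (h : ℝ) (i₀ : Fin d) (σ : (Fin d → Fin N) × Fin k)
    (r : ℝ) : Set (Fin d → ℝ) :=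
  {x ∈ box C h σ | x i₀ ≤ boxCorner C σ i₀ + r}

section Boxes

variable {d k N : ℕ} (C : Necklace d) {h : ℝ}

theorem box_eq_pi (σ : (Fin d → Fin N) × Fin k) :
    box C h σ = Set.univ.pi fun i => Set.Ico (boxCorner C σ i) (boxCorner C σ i + h) := by
  ext x
  simp [box]

theorem measurableSet_box (σ : (Fin d → Fin N) × Fin k) : MeasurableSet (box C h σ) := by
  rw [box_eq_pi]
  exact MeasurableSet.univ_pi fun i => measurableSet_Ico

theorem measurableSet_spot (i₀ : Fin d) (σ : (Fin d → Fin N) × Fin k) (r : ℝ) :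
    MeasurableSet (spot C h i₀ σ r) :=
  (measurableSet_box C σ).inter (measurableSet_le (measurable_pi_apply i₀) measurable_const)

theorem volume_box (hh : 0 ≤ h) (σ : (Fin d → Fin N) × Fin k) :
    volume (box C h σ) = ENNReal.ofReal (h ^ d) := by
  rw [box_eq_pi, Real.volume_pi_Ico]
  simp [ENNReal.ofReal_pow hh]

theorem volume_real_spot (i₀ : Fin d) (σ : (Fin d → Fin N) × Fin k) {r : ℝ} (hr : 0 ≤ r)
    (hrh : r < h) : volume.real (spot C h i₀ σ r) = h ^ (d - 1) * r := by
  have hh : 0 ≤ h := hr.trans hrh.le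
  have heq : spot C h i₀ σ r = Set.univ.pi fun i =>
      if i = i₀ then Set.Icc (boxCorner C σ i) (boxCorner C σ i + r)
        else Set.Ico (boxCorner C σ i) (boxCorner C σ i + h) := by
    ext x
    simp only [spot, box, Set.mem_ofPred_eq, Set.mem_univ_pi]
    constructor
    · rintro ⟨hx, hxr⟩ i
      split_ifs with hi
      · subst hi
        exact ⟨(hx i).1, hxr⟩
      · exact hx i
    · intro hx
      have h0 := hx i₀
      rw [if_pos rfl] at h0
      refine ⟨fun i => ?_, h0.2⟩
      by_cases hi : i = i₀
      · subst hi
        exact ⟨h0.1, h0.2.trans_lt (by linarith)⟩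
      · simpa only [if_neg hi] using hx i
  have hprod : ∀ j ∈ Finset.univ.erase i₀,
      volume (if j = i₀ then Set.Icc (boxCorner C σ j) (boxCorner C σ j + r)
        else Set.Ico (boxCorner C σ j) (boxCorner C σ j + h)) = ENNReal.ofReal h := by
    intro j hj
    rw [if_neg (Finset.ne_of_mem_erase hj)]
    simp
  rw [measureReal_def, heq, volume_pi_pi, ← Finset.mul_prod_erase _ _ (Finset.mem_univ i₀),
    Finset.prod_congr rfl hprod, if_pos rfl, Finset.prod_const,
    Finset.card_erase_of_mem (Finset.mem_univ i₀), Finset.card_univ, Fintype.card_fin,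
    Real.volume_Icc, add_sub_cancel_left, ENNReal.toReal_mul, ENNReal.toReal_pow,
    ENNReal.toReal_ofReal hh, ENNReal.toReal_ofReal hr, mul_comm]

/-- The boxes fit into cells of the finer grid of mesh `C.side / (N * k)`, with `i`-th index `k *
σ.1 i + σ.2`. Division by `k` recovers the coarse cell and the color; `0 < d` provides a coordinate
for reading off the color. -/
theorem eq_of_mem_box (hd : 0 < d) (hN : 0 < N) (hk : 0 < k) (hh : h ≤ C.side / (N * k))
    {σ τ : (Fin d → Fin N) × Fin k} {x : Fin d → ℝ} (hσ : x ∈ box C h σ)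
    (hτ : x ∈ box C h τ) : σ = τ := by
  have hs : 0 < C.side / (N * k) := by
    have := C.side_pos
    positivity
  have hlt : ∀ (σ τ : (Fin d → Fin N) × Fin k), x ∈ box C h σ → x ∈ box C h τ → ∀ i,
      k * (σ.1 i : ℕ) + (σ.2 : ℕ) < k * (τ.1 i : ℕ) + (τ.2 : ℕ) + 1 := by
    intro σ τ hσ hτ i
    have h1 := (hσ i).1
    have h2 := (hτ i).2
    simp only [boxCorner] at h1 h2
    have h3 : C.side / (N * k) * ((k * (σ.1 i : ℕ) + (σ.2 : ℕ) : ℕ) : ℝ)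
        < C.side / (N * k) * ((k * (τ.1 i : ℕ) + (τ.2 : ℕ) + 1 : ℕ) : ℝ) := by
      push_cast at h1 h2 ⊢
      linarith
    exact Nat.cast_lt.1 (lt_of_mul_lt_mul_left h3 hs.le)
  have heq : ∀ i, k * (σ.1 i : ℕ) + (σ.2 : ℕ) = k * (τ.1 i : ℕ) + (τ.2 : ℕ) := fun i => by
    have h1 := hlt σ τ hσ hτ i
    have h2 := hlt τ σ hτ hσ i
    omega
  have hdiv : ∀ i, (σ.1 i : ℕ) = τ.1 i := fun i => by
    have := congrArg (· / k) (heq i)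
    simpa [Nat.mul_add_div hk, Nat.div_eq_of_lt σ.2.2, Nat.div_eq_of_lt τ.2.2] using this
  refine Prod.ext (funext fun i => Fin.ext (hdiv i)) (Fin.ext ?_)
  have := heq ⟨0, hd⟩
  rw [hdiv] at this
  omega

theorem cell_bounds_of_mem_box (hN : 0 < N) (hk : 0 < k) (hh : h ≤ C.side / (N * k))
    {σ : (Fin d → Fin N) × Fin k} {x : Fin d → ℝ} (hσ : x ∈ box C h σ) (i : Fin d) :
    C.corner i + C.side / N * (σ.1 i : ℕ) ≤ x i ∧
      x i ≤ C.corner i + C.side / N * ((σ.1 i : ℕ) + 1) := by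
  have hs : 0 < C.side / (N * k) := by
    have := C.side_pos
    positivity
  have hNk : C.side / N = C.side / (N * k) * k := by
    have : (k : ℝ) ≠ 0 := by positivity
    field_simp
  obtain ⟨h1, h2⟩ := hσ i
  simp only [boxCorner] at h1 h2
  push_cast at h1 h2
  have h3 : ((σ.2 : ℕ) : ℝ) + 1 ≤ k := by exact_mod_cast σ.2.2
  have h4 := mul_le_mul_of_nonneg_left h3 hs.le
  have h5 : 0 ≤ C.side / (N * k) * ((σ.2 : ℕ) : ℝ) := by positivity
  rw [hNk]
  constructor <;> nlinarith

theorem box_subset (hN : 0 < N) (hk : 0 < k) (hh : h ≤ C.side / (N * k))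
    (σ : (Fin d → Fin N) × Fin k) : box C h σ ⊆ C.toSet := by
  have hN' : (0 : ℝ) < N := by exact_mod_cast hN
  have hs : 0 < C.side / N := div_pos C.side_pos hN'
  refine fun x hx => ⟨fun i => ?_, fun i => ?_⟩
  · have := (cell_bounds_of_mem_box C hN hk hh hx i).1
    have h0 : 0 ≤ C.side / N * ((σ.1 i : ℕ) : ℝ) := by positivity
    linarith
  · have h1 := (cell_bounds_of_mem_box C hN hk hh hx i).2
    have h2 : (((σ.1 i : ℕ) : ℝ) + 1) ≤ N := by exact_mod_cast (σ.1 i).2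
    have h3 := mul_le_mul_of_nonneg_left h2 hs.le
    rw [div_mul_cancel₀ _ hN'.ne'] at h3
    change x i ≤ C.corner i + C.side
    linarith

end Boxes

section Recolor

variable {d k N : ℕ} (C : Necklace d) (h : ℝ) (i₀ : Fin d) (c₀ : Fin k)
  (f : (Fin d → ℝ) → Fin k) (θ : (Fin d → Fin N) × Fin k → ℝ)

open Classical in
/-- Recolors each box `σ`: with the color `σ.2` below the threshold `θ σ`, with `c₀` above it. -/
def recolor (x : Fin d → ℝ) : Fin k :=
  if hx : ∃ σ, x ∈ box C h σ then
    (if x ∈ spot C h i₀ hx.choose (θ hx.choose) then hx.choose.2 else c₀)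
  else f x

variable {h}

theorem recolor_of_notMem {x : Fin d → ℝ} (hx : ∀ σ : (Fin d → Fin N) × Fin k, x ∉ box C h σ) :
    recolor C h i₀ c₀ f θ x = f x :=
  dif_neg fun ⟨σ, hσ⟩ => hx σ hσ

open Classical in
theorem recolor_of_mem (hN : 0 < N) (hh : h ≤ C.side / (N * k))
    {σ : (Fin d → Fin N) × Fin k} {x : Fin d → ℝ} (hx : x ∈ box C h σ) :
    recolor C h i₀ c₀ f θ x = if x ∈ spot C h i₀ σ (θ σ) then σ.2 else c₀ := by
  have hex : ∃ σ : (Fin d → Fin N) × Fin k, x ∈ box C h σ := ⟨σ, hx⟩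
  have : hex.choose = σ := eq_of_mem_box C i₀.pos hN c₀.pos hh hex.choose_spec hx
  rw [recolor, dif_pos hex, this]

/-- The color `c₀` is excluded because it also fills the boxes above their thresholds. -/
theorem recolor_eq_iff (hN : 0 < N) (hh : h ≤ C.side / (N * k)) {c : Fin k} (hc : c ≠ c₀)
    (x : Fin d → ℝ) :
    recolor C h i₀ c₀ f θ x = c ↔ (f x = c ∧ ∀ σ : (Fin d → Fin N) × Fin k, x ∉ box C h σ) ∨
      ∃ σ : (Fin d → Fin N) × Fin k, σ.2 = c ∧ x ∈ spot C h i₀ σ (θ σ) := by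
  by_cases hx : ∃ σ : (Fin d → Fin N) × Fin k, x ∈ box C h σ
  · obtain ⟨σ, hσ⟩ := hx
    rw [recolor_of_mem C i₀ c₀ f θ hN hh hσ]
    constructor
    · intro hcol
      split_ifs at hcol with hs
      · exact Or.inr ⟨σ, hcol, hs⟩
      · exact absurd hcol.symm hc
    · rintro (⟨-, hn⟩ | ⟨τ, hτc, hτ⟩)
      · exact absurd hσ (hn σ)
      · obtain rfl := eq_of_mem_box C i₀.pos hN c₀.pos hh hσ hτ.1
        rw [if_pos hτ, hτc]
  · push Not at hx
    rw [recolor_of_notMem C i₀ c₀ f θ hx]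
    exact ⟨fun hf => Or.inl ⟨hf, hx⟩, fun hor => hor.elim (fun h1 => h1.1)
      fun ⟨σ, _, hs⟩ => absurd hs.1 (hx σ)⟩

theorem nullMeasurableSet_recolor_of_ne (hN : 0 < N) (hh : h ≤ C.side / (N * k))
    (hf : ∀ c, NullMeasurableSet (f ⁻¹' {c}) volume) {c : Fin k} (hc : c ≠ c₀) :
    NullMeasurableSet (recolor C h i₀ c₀ f θ ⁻¹' {c}) volume := by
  have : recolor C h i₀ c₀ f θ ⁻¹' {c}
      = (f ⁻¹' {c} \ ⋃ σ : (Fin d → Fin N) × Fin k, box C h σ)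
        ∪ ⋃ (σ : (Fin d → Fin N) × Fin k) (_ : σ.2 = c), spot C h i₀ σ (θ σ) := by
    ext x
    simp only [Set.mem_preimage, Set.mem_singleton_iff, recolor_eq_iff C i₀ c₀ f θ hN hh hc,
      Set.mem_union, Set.mem_sdiff, Set.mem_iUnion, not_exists, exists_prop]
  rw [this]
  exact ((hf c).diff (MeasurableSet.iUnion fun σ =>
    measurableSet_box C σ).nullMeasurableSet).union
    (MeasurableSet.iUnion fun σ => MeasurableSet.iUnion fun _ =>
      measurableSet_spot C i₀ σ _).nullMeasurableSet

theorem nullMeasurableSet_recolor (hN : 0 < N) (hh : h ≤ C.side / (N * k))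
    (hf : ∀ c, NullMeasurableSet (f ⁻¹' {c}) volume) (c : Fin k) :
    NullMeasurableSet (recolor C h i₀ c₀ f θ ⁻¹' {c}) volume := by
  by_cases hc : c = c₀
  · have : recolor C h i₀ c₀ f θ ⁻¹' {c}
        = (⋃ c' : {c' : Fin k // c' ≠ c₀}, recolor C h i₀ c₀ f θ ⁻¹' {c'.1})ᶜ := by
      ext x
      simp only [hc, Set.mem_preimage, Set.mem_singleton_iff, Set.mem_compl_iff, Set.mem_iUnion,
        not_exists, Subtype.forall]
      exact ⟨fun h1 c' hc' h2 => hc' (h2.symm.trans h1), fun h1 => not_not.1 fun h2 => h1 _ h2 rfl⟩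
    rw [this]
    have hne : ∀ c' : {c' : Fin k // c' ≠ c₀},
        NullMeasurableSet (recolor C h i₀ c₀ f θ ⁻¹' {c'.1}) volume := fun c' =>
      nullMeasurableSet_recolor_of_ne C i₀ c₀ f θ hN hh hf c'.2
    exact (NullMeasurableSet.iUnion hne).compl
  · exact nullMeasurableSet_recolor_of_ne C i₀ c₀ f θ hN hh hf hc

/-- The volume of a color other than `c₀` in a region `R`. -/
theorem volume_real_recolor_inter (hN : 0 < N) (hh : h ≤ C.side / (N * k)) {c : Fin k}
    (hc : c ≠ c₀) {R : Set (Fin d → ℝ)} (hR : MeasurableSet R) (hRC : R ⊆ C.toSet) :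
    volume.real (recolor C h i₀ c₀ f θ ⁻¹' {c} ∩ R)
      = volume.real ((f ⁻¹' {c} \ ⋃ σ : (Fin d → Fin N) × Fin k, box C h σ) ∩ R)
        + ∑ σ : (Fin d → Fin N) × Fin k,
          if σ.2 = c then volume.real (spot C h i₀ σ (θ σ) ∩ R) else 0 := by
  have heq : recolor C h i₀ c₀ f θ ⁻¹' {c} ∩ R
      = ((f ⁻¹' {c} \ ⋃ σ : (Fin d → Fin N) × Fin k, box C h σ) ∩ R)
        ∪ ⋃ σ ∈ Finset.univ.filter fun σ : (Fin d → Fin N) × Fin k => σ.2 = c,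
          (spot C h i₀ σ (θ σ) ∩ R) := by
    ext x
    simp only [Set.mem_preimage, Set.mem_singleton_iff, recolor_eq_iff C i₀ c₀ f θ hN hh hc,
      Set.mem_union, Set.mem_inter_iff, Set.mem_sdiff, Set.mem_iUnion, not_exists, exists_prop,
      Finset.mem_filter, Finset.mem_univ, true_and, or_and_right, ← and_assoc,
      ← exists_and_right]
  have hsm : ∀ σ ∈ Finset.univ.filter fun σ : (Fin d → Fin N) × Fin k => σ.2 = c,
      MeasurableSet (spot C h i₀ σ (θ σ) ∩ R) := fun σ _ =>
    (measurableSet_spot C i₀ σ _).inter hR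
  rw [heq, measureReal_union ?_ (Finset.measurableSet_biUnion _ hsm)
      (C.volume_ne_top (Set.inter_subset_right.trans hRC))
      (C.volume_ne_top (Set.iUnion₂_subset fun σ _ => Set.inter_subset_right.trans hRC)),
    ← Finset.sum_filter, measureReal_biUnion_finset ?_ hsm
      fun σ _ => C.volume_ne_top (Set.inter_subset_right.trans hRC)]
  · intro σ _ τ _ hne
    refine Set.disjoint_left.2 fun x hx hx' => hne ?_
    exact eq_of_mem_box C i₀.pos hN c₀.pos hh hx.1.1 hx'.1.1
  · refine Set.disjoint_left.2 fun x hx hx' => hx.1.2 ?_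
    simp only [Set.mem_iUnion] at hx' ⊢
    obtain ⟨σ, -, hσ⟩ := hx'
    exact ⟨σ, hσ.1.1⟩

end Recolor

/-! ### Almost all thresholds obstruct fair splittings -/

/-- The volume of the color `c` in the region `l`, for the thresholds `θ` and the cuts `z`. -/
def colorVolume {d k N q : ℕ} (C : Necklace d) (h : ℝ) (i₀ : Fin d) (c₀ : Fin k)
    (f : (Fin d → ℝ) → Fin k) {cuts : Fin d → ℕ}
    (label : ((i : Fin d) → Fin (cuts i + 1)) → Fin q)
    (θ : (Fin d → Fin N) × Fin k → ℝ) (z : (Σ i, Fin (cuts i)) → ℝ) (c : Fin k) (l : Fin q) : ℝ :=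
  volume.real (recolor C h i₀ c₀ f θ ⁻¹' {c} ∩ region C z label l)

/-- Thresholds and cut positions enter only through coordinate comparisons, so moving each of them
changes the volume by at most that of a slab. -/
theorem abs_colorVolume_sub_le {d k N q : ℕ} (C : Necklace d) (h : ℝ) (i₀ : Fin d) (c₀ : Fin k)
    (f : (Fin d → ℝ) → Fin k) {cuts : Fin d → ℕ}
    (label : ((i : Fin d) → Fin (cuts i + 1)) → Fin q)
    (θ θ' : (Fin d → Fin N) × Fin k → ℝ) (z z' : (Σ i, Fin (cuts i)) → ℝ) (c : Fin k)
    (l : Fin q) {ε : ℝ} (hθ : ∀ σ, |θ σ - θ' σ| ≤ ε) (hz : ∀ m, |z m - z' m| ≤ ε) :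
    |colorVolume C h i₀ c₀ f label θ z c l - colorVolume C h i₀ c₀ f label θ' z' c l|
      ≤ Fintype.card (((Fin d → Fin N) × Fin k) ⊕ (Σ i, Fin (cuts i)))
        * (C.side ^ (d - 1) * ε) := by
  refine (C.abs_volume_real_sub_le (ι := ((Fin d → Fin N) × Fin k) ⊕ (Σ i, Fin (cuts i)))
    (Sum.elim (fun _ => i₀) fun m => m.1)
    (Sum.elim (fun σ => boxCorner C σ i₀ + θ σ) z)
    (Sum.elim (fun σ => boxCorner C σ i₀ + θ' σ) z')
    (fun x hx => hx.2.1) (fun x hx => hx.2.1) ?_).trans ?_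
  · intro x hx hcmp
    have h1 : recolor C h i₀ c₀ f θ x = recolor C h i₀ c₀ f θ' x := by
      have hs : ∀ σ, x ∈ spot C h i₀ σ (θ σ) ↔ x ∈ spot C h i₀ σ (θ' σ) := by
        intro σ
        have := not_congr (hcmp (Sum.inl σ))
        simp only [Sum.elim_inl, not_lt] at this
        simp only [spot, Set.mem_ofPred_eq, this]
      unfold recolor
      split_ifs with hb h1 h2 h2
      · rfl
      · exact absurd ((hs _).1 h1) h2
      · exact absurd ((hs _).2 h2) h1
      · rfl
      · rfl
    have h2 : cutCount z x = cutCount z' x := by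
      funext i
      refine Fin.ext ?_
      have : ∀ m, z ⟨i, m⟩ < x i ↔ z' ⟨i, m⟩ < x i := fun m => hcmp (Sum.inr ⟨i, m⟩)
      simp only [cutCount, this]
    simp only [region, Set.mem_inter_iff, Set.mem_preimage, Set.mem_singleton_iff,
      Set.mem_ofPred_eq, h1, h2]
  · refine (Finset.sum_le_card_nsmul _ _ (C.side ^ (d - 1) * ε) ?_).trans ?_
    · rintro (σ | m) -
      · refine mul_le_mul_of_nonneg_left ?_ (pow_nonneg C.side_pos.le _)
        simpa using hθ σ
      · exact mul_le_mul_of_nonneg_left (hz m) (pow_nonneg C.side_pos.le _)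
    · rw [nsmul_eq_mul, Finset.card_univ]

open Classical in
/-- Given the positions of the cuts as the coordinates in the range of `e`, and the remaining
thresholds, computes the thresholds in the range of `e` from the balance of the parts. -/
def solveThresholds {d k N q : ℕ} (C : Necklace d) (h : ℝ) (i₀ : Fin d) (c₀ : Fin k)
    (f : (Fin d → ℝ) → Fin k) {cuts : Fin d → ℕ}
    (label : ((i : Fin d) → Fin (cuts i + 1)) → Fin q) (l₀ : Fin q)
    (target : (Fin d → Fin N) × Fin k → Fin q)
    (e : (Σ i, Fin (cuts i)) → (Fin d → Fin N) × Fin k) (w : (Fin d → Fin N) × Fin k → ℝ)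
    (σ : (Fin d → Fin N) × Fin k) : ℝ :=
  -- The threshold `-1` empties the spots of the boxes being solved for, so the right side does not
  -- depend on the unknowns. A spot with threshold `r` has volume `h ^ (d - 1) * r`, whence the
  -- division.
  if σ ∈ Set.range e then
    (colorVolume C h i₀ c₀ f label (fun τ => if τ ∈ Set.range e then -1 else w τ) (w ∘ e) σ.2 l₀
      - colorVolume C h i₀ c₀ f label (fun τ => if τ ∈ Set.range e then -1 else w τ) (w ∘ e) σ.2
        (target σ)) / h ^ (d - 1)
  else w σ

theorem exists_lipschitzWith_solveThresholds {d k N q : ℕ} (C : Necklace d) {h : ℝ} (hh : 0 < h)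
    (i₀ : Fin d) (c₀ : Fin k) (f : (Fin d → ℝ) → Fin k) {cuts : Fin d → ℕ}
    (label : ((i : Fin d) → Fin (cuts i + 1)) → Fin q) (l₀ : Fin q)
    (target : (Fin d → Fin N) × Fin k → Fin q)
    (e : (Σ i, Fin (cuts i)) → (Fin d → Fin N) × Fin k) :
    ∃ K, LipschitzWith K (solveThresholds C h i₀ c₀ f label l₀ target e) := by
  set M : ℝ := Fintype.card (((Fin d → Fin N) × Fin k) ⊕ (Σ i, Fin (cuts i)))
    * C.side ^ (d - 1) with hM
  have hM0 : 0 ≤ M := mul_nonneg (Nat.cast_nonneg _) (pow_nonneg C.side_pos.le _)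
  have hp : 0 < h ^ (d - 1) := pow_pos hh _
  have hK0 : 0 ≤ 1 + 2 * M / h ^ (d - 1) := by positivity
  refine ⟨(1 + 2 * M / h ^ (d - 1)).toNNReal, LipschitzWith.of_dist_le_mul fun w w' => ?_⟩
  rw [Real.coe_toNNReal _ hK0]
  have hD : 0 ≤ dist w w' := dist_nonneg
  have hww : ∀ σ, |w σ - w' σ| ≤ dist w w' := fun σ => by
    rw [← Real.dist_eq]
    exact dist_le_pi_dist w w' σ
  refine (dist_pi_le_iff (mul_nonneg hK0 hD)).2 fun σ => ?_
  rw [Real.dist_eq]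
  unfold solveThresholds
  split_ifs with hσ
  · have hcv : ∀ l, |colorVolume C h i₀ c₀ f label
          (fun τ => if τ ∈ Set.range e then -1 else w τ) (w ∘ e) σ.2 l
        - colorVolume C h i₀ c₀ f label
          (fun τ => if τ ∈ Set.range e then -1 else w' τ) (w' ∘ e) σ.2 l| ≤ M * dist w w' := by
      intro l
      refine (abs_colorVolume_sub_le C h i₀ c₀ f label _ _ _ _ σ.2 l (ε := dist w w') ?_
        fun m => hww (e m)).trans (le_of_eq (by rw [hM, mul_assoc]))
      intro τ
      split_ifs
      · simp
      · exact hww τ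
    have h1 := hcv l₀
    have h2 := hcv (target σ)
    rw [← sub_div, abs_div, abs_of_pos hp, div_le_iff₀ hp]
    have h3 : (1 + 2 * M / h ^ (d - 1)) * dist w w' * h ^ (d - 1)
        = dist w w' * h ^ (d - 1) + 2 * (M * dist w w') := by
      field_simp
    have h4 : 0 ≤ dist w w' * h ^ (d - 1) := mul_nonneg hD hp.le
    rw [h3]
    rw [abs_le] at h1 h2 ⊢
    constructor <;> linarith
  · have h1 := hww σ
    have h3 : (1 + 2 * M / h ^ (d - 1)) * dist w w'
        = dist w w' + 2 * M / h ^ (d - 1) * dist w w' := by ring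
    have h4 : 0 ≤ 2 * M / h ^ (d - 1) * dist w w' := by positivity
    linarith

theorem colorVolume_sub {d k N q : ℕ} (C : Necklace d) {h : ℝ} (i₀ : Fin d) (c₀ : Fin k)
    (f : (Fin d → ℝ) → Fin k) (hN : 0 < N) (hh : h ≤ C.side / (N * k)) {cuts : Fin d → ℕ}
    (label : ((i : Fin d) → Fin (cuts i + 1)) → Fin q)
    (θ θ' : (Fin d → Fin N) × Fin k → ℝ) (z : (Σ i, Fin (cuts i)) → ℝ) {c : Fin k}
    (hc : c ≠ c₀) (l : Fin q) :
    colorVolume C h i₀ c₀ f label θ z c l - colorVolume C h i₀ c₀ f label θ' z c l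
      = ∑ σ : (Fin d → Fin N) × Fin k, if σ.2 = c then
          volume.real (spot C h i₀ σ (θ σ) ∩ region C z label l)
            - volume.real (spot C h i₀ σ (θ' σ) ∩ region C z label l) else 0 := by
  have hR := measurableSet_region C z label l
  have hRC : region C z label l ⊆ C.toSet := fun x hx => hx.1
  rw [colorVolume, colorVolume, volume_real_recolor_inter C i₀ c₀ f θ hN hh hc hR hRC,
    volume_real_recolor_inter C i₀ c₀ f θ' hN hh hc hR hRC, add_sub_add_left_eq_sub,
    ← Finset.sum_sub_distrib]
  exact Finset.sum_congr rfl fun σ _ => by split_ifs <;> simp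

theorem volume_real_spot_inter_of_ae_mem {d k N q : ℕ} (C : Necklace d) {h : ℝ} (i₀ : Fin d)
    {cuts : Fin d → ℕ} (label : ((i : Fin d) → Fin (cuts i + 1)) → Fin q)
    (z : (Σ i, Fin (cuts i)) → ℝ) {σ : (Fin d → Fin N) × Fin k} {l : Fin q}
    (hσ : ∀ᵐ x, x ∈ box C h σ → x ∈ region C z label l) (r : ℝ) :
    volume.real (spot C h i₀ σ r ∩ region C z label l) = volume.real (spot C h i₀ σ r) := by
  refine measureReal_congr (Filter.eventuallyEq_set.2 ?_)
  filter_upwards [hσ] with x hx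
  exact ⟨fun hs => hs.1, fun hs => ⟨hs, hx hs.1⟩⟩

theorem volume_real_spot_inter_of_ae_mem_ne {d k N q : ℕ} (C : Necklace d) {h : ℝ} (i₀ : Fin d)
    {cuts : Fin d → ℕ} (label : ((i : Fin d) → Fin (cuts i + 1)) → Fin q)
    (z : (Σ i, Fin (cuts i)) → ℝ) {σ : (Fin d → Fin N) × Fin k} {l l' : Fin q} (hl : l' ≠ l)
    (hσ : ∀ᵐ x, x ∈ box C h σ → x ∈ region C z label l') (r : ℝ) :
    volume.real (spot C h i₀ σ r ∩ region C z label l) = 0 := by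
  rw [measureReal_def, measure_eq_zero_iff_ae_notMem.2, ENNReal.toReal_zero]
  filter_upwards [hσ] with x hx hs
  exact hl ((hx hs.1.1).2.symm.trans hs.2.2)

/-- Emptying the solved boxes leaves the part `l₀` untouched. In the part `target (e m)` the color
of `e m` loses exactly the spot of `e m`, because no other solved box has this color and this part.
Balance then determines the threshold of `e m`. -/
theorem solveThresholds_extend {d k N q : ℕ} (C : Necklace d) {h : ℝ} (i₀ : Fin d) (c₀ : Fin k)
    (f : (Fin d → ℝ) → Fin k) (hN : 0 < N) (h0 : 0 < h) (hh : h ≤ C.side / (N * k))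
    {cuts : Fin d → ℕ} (label : ((i : Fin d) → Fin (cuts i + 1)) → Fin q) (l₀ : Fin q)
    (target : (Fin d → Fin N) × Fin k → Fin q)
    (e : (Σ i, Fin (cuts i)) → (Fin d → Fin N) × Fin k) (he : Function.Injective e)
    (θ : (Fin d → Fin N) × Fin k → ℝ) (hθ : ∀ σ, θ σ ∈ Set.Ioo 0 h)
    (z : (Σ i, Fin (cuts i)) → ℝ)
    (hbal : ∀ c l, colorVolume C h i₀ c₀ f label θ z c l = colorVolume C h i₀ c₀ f label θ z c l₀)
    (hc : ∀ m, (e m).2 ≠ c₀) (hl : ∀ m, target (e m) ≠ l₀)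
    (hmem : ∀ m, ∀ᵐ x, x ∈ box C h (e m) → x ∈ region C z label (target (e m)))
    (hinj : ∀ m m', (e m).2 = (e m').2 → target (e m) = target (e m') → m = m') :
    solveThresholds C h i₀ c₀ f label l₀ target e (Function.extend e z θ) = θ := by
  classical
  funext σ
  unfold solveThresholds
  set θ' : (Fin d → Fin N) × Fin k → ℝ :=
    fun τ => if τ ∈ Set.range e then -1 else Function.extend e z θ τ with hθ'
  have hout : ∀ τ, τ ∉ Set.range e → Function.extend e z θ τ = θ τ := fun τ hτ =>
    Function.extend_apply' _ _ _ hτ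
  have hz : Function.extend e z θ ∘ e = z := funext fun m => he.extend_apply _ _ m
  rw [hz]
  split_ifs with hσ
  swap
  · exact hout σ hσ
  obtain ⟨m, rfl⟩ := hσ
  have hθ'out : ∀ τ, τ ∉ Set.range e → θ' τ = θ τ := fun τ hτ => by
    simp only [hθ', if_neg hτ, hout τ hτ]
  have hsub₀ := colorVolume_sub C i₀ c₀ f hN hh label θ θ' z (hc m) l₀
  rw [Finset.sum_eq_zero] at hsub₀
  swap
  · intro τ _
    by_cases hτ : τ ∈ Set.range e
    · obtain ⟨m', rfl⟩ := hτ
      rw [volume_real_spot_inter_of_ae_mem_ne C i₀ label z (hl m') (hmem m'),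
        volume_real_spot_inter_of_ae_mem_ne C i₀ label z (hl m') (hmem m'), sub_self, ite_self]
    · rw [hθ'out τ hτ, sub_self, ite_self]
  have hsub := colorVolume_sub C i₀ c₀ f hN hh label θ θ' z (hc m) (target (e m))
  rw [Finset.sum_eq_single (e m)] at hsub
  · have hempty : spot C h i₀ (e m) (θ' (e m)) = ∅ := by
      refine Set.eq_empty_of_forall_notMem fun x hx => ?_
      have h1 := hx.2
      have h2 := (hx.1 i₀).1
      simp only [hθ', Set.mem_range_self, if_true] at h1
      linarith
    rw [if_pos rfl, hempty, Set.empty_inter, measureReal_empty, sub_zero,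
      volume_real_spot_inter_of_ae_mem C i₀ label z (hmem m),
      volume_real_spot C i₀ _ (hθ _).1.le (hθ _).2, hbal] at hsub
    have hp : 0 < h ^ (d - 1) := pow_pos h0 _
    rw [div_eq_iff hp.ne']
    linarith
  · intro τ _ hne
    by_cases hτ : τ ∈ Set.range e
    · obtain ⟨m', rfl⟩ := hτ
      split_ifs with hcc
      · have hne' : target (e m') ≠ target (e m) := fun ht => hne (congrArg e (hinj m' m hcc ht))
        rw [volume_real_spot_inter_of_ae_mem_ne C i₀ label z hne' (hmem m'),
          volume_real_spot_inter_of_ae_mem_ne C i₀ label z hne' (hmem m'), sub_self]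
      · rfl
    · rw [hθ'out τ hτ, sub_self, ite_self]
  · exact fun hm => absurd (Finset.mem_univ _) hm

/-- A part with a `q`-th of the volume contains a cell of a fine enough grid. -/
theorem exists_cell_subset_region {d k N q t : ℕ} {C : Necklace d} {h : ℝ} (hq : 0 < q)
    (hk : 0 < k) (hN : 2 * (q * (t + 1) ^ d) ≤ N) (hh : h ≤ C.side / (N * k))
    (s : Splitting C q) (hs : s.size ≤ t) (l : Fin q)
    (hvol : volume.real (region C s.inner s.label l) = C.side ^ d / q) :
    ∃ n : Fin d → Fin N, ∀ c : Fin k, ∀ᵐ x, x ∈ box C h (n, c) →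
      x ∈ region C s.inner s.label l := by
  have hL := C.side_pos
  have hN0 : 0 < N := lt_of_lt_of_le (by positivity) hN
  have hN' : (0 : ℝ) < N := by exact_mod_cast hN0
  have hcard : (Fintype.card ((i : Fin d) → Fin (s.cuts i + 1)) : ℝ) ≤ (t + 1) ^ d := by
    have : Fintype.card ((i : Fin d) → Fin (s.cuts i + 1)) ≤ (t + 1) ^ d := by
      rw [Fintype.card_pi]
      simp only [Fintype.card_fin]
      refine (Finset.prod_le_pow_card _ _ (t + 1) fun i _ => ?_).trans (by simp)
      exact Nat.succ_le_succ ((Finset.single_le_sum (fun i _ => Nat.zero_le (s.cuts i))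
        (Finset.mem_univ i)).trans hs)
    exact_mod_cast this
  have hη : 0 < C.side ^ d / (q * (t + 1) ^ d) := by positivity
  -- Pigeonhole: there are at most `(t + 1) ^ d` cuboids, so one with label `l` has at least the
  -- average volume.
  obtain ⟨j, -, hj⟩ := Finset.exists_le_of_sum_le (s := Finset.univ)
    (f := fun _ : (i : Fin d) → Fin (s.cuts i + 1) => C.side ^ d / (q * (t + 1) ^ d))
    (g := fun j => if s.label j = l then volume.real (s.piece j) else 0)
    Finset.univ_nonempty (by
      rw [← s.volume_real_region, hvol, Finset.sum_const, Finset.card_univ, nsmul_eq_mul]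
      refine (mul_le_mul_of_nonneg_right hcard hη.le).trans (le_of_eq ?_)
      field_simp)
  have hlabel : s.label j = l := by
    by_contra hne
    rw [if_neg hne] at hj
    linarith
  rw [if_pos hlabel, s.volume_real_piece] at hj
  -- The other `d - 1` sides are at most `C.side`, so this one is at least `C.side / (q * (t + 1) ^
  -- d)`. The factor `2` in `hN` makes it span two grid steps, enough for a full cell after rounding
  -- up.
  have hside : ∀ i, 2 * (C.side / N) ≤ s.pos i (j i).succ - s.pos i (j i).castSucc := by
    intro i
    have hnn : ∀ i', 0 ≤ s.pos i' (j i').succ - s.pos i' (j i').castSucc := fun i' =>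
      sub_nonneg.2 (s.pos_monotone i' (Fin.castSucc_lt_succ).le)
    have hle : ∀ i', s.pos i' (j i').succ - s.pos i' (j i').castSucc ≤ C.side := by
      intro i'
      have h1 := s.pos_monotone i' (Fin.zero_le (j i').castSucc)
      have h2 := s.pos_monotone i' (Fin.le_last (j i').succ)
      rw [s.pos_first] at h1
      rw [s.pos_last] at h2
      linarith
    have hd : d = d - 1 + 1 := by
      have := i.pos
      omega
    have hprod : ∏ i' ∈ Finset.univ.erase i, (s.pos i' (j i').succ - s.pos i' (j i').castSucc)
        ≤ C.side ^ (d - 1) := by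
      refine (Finset.prod_le_prod (fun i' _ => hnn i') fun i' _ => hle i').trans ?_
      rw [Finset.prod_const, Finset.card_erase_of_mem (Finset.mem_univ i), Finset.card_univ,
        Fintype.card_fin]
    rw [← Finset.mul_prod_erase _ _ (Finset.mem_univ i)] at hj
    have h1 := hj.trans (mul_le_mul_of_nonneg_left hprod (hnn i))
    have h2 : C.side ^ d / (q * (t + 1) ^ d) = C.side / (q * (t + 1) ^ d) * C.side ^ (d - 1) := by
      rw [div_mul_eq_mul_div, ← pow_succ', ← hd]
    rw [h2] at h1
    refine le_trans ?_ (le_of_mul_le_mul_right h1 (pow_pos hL _))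
    have hNr : 2 * ((q : ℝ) * (t + 1) ^ d) ≤ N := by exact_mod_cast hN
    rw [← mul_div_assoc, div_le_div_iff₀ hN' (by positivity)]
    nlinarith
  set δ := C.side / N with hδ
  have hδ0 : 0 < δ := div_pos hL hN'
  have hNδ : δ * N = C.side := div_mul_cancel₀ _ hN'.ne'
  have hcell : ∀ i, ∃ n : Fin N, s.pos i (j i).castSucc ≤ C.corner i + δ * (n : ℕ) ∧
      C.corner i + δ * ((n : ℕ) + 1) ≤ s.pos i (j i).succ := by
    intro i
    have h1 := s.pos_monotone i (Fin.zero_le (j i).castSucc)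
    have h2 := s.pos_monotone i (Fin.le_last (j i).succ)
    rw [s.pos_first] at h1
    rw [s.pos_last] at h2
    have h3 := hside i
    set y := (s.pos i (j i).castSucc - C.corner i) / δ with hy
    have hy0 : 0 ≤ y := div_nonneg (by linarith) hδ0.le
    have hyδ : δ * y = s.pos i (j i).castSucc - C.corner i := mul_div_cancel₀ _ hδ0.ne'
    have h4 := mul_le_mul_of_nonneg_left (Nat.le_ceil y) hδ0.le
    have h5 := mul_lt_mul_of_pos_left (Nat.ceil_lt_add_one hy0) hδ0
    have h6 : ⌈y⌉₊ < N := by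
      have : δ * (⌈y⌉₊ : ℝ) < δ * N := by linarith
      exact_mod_cast lt_of_mul_lt_mul_left this hδ0.le
    refine ⟨⟨⌈y⌉₊, h6⟩, ?_, ?_⟩
    · simp only
      linarith
    · simp only
      linarith
  choose n hn using hcell
  refine ⟨n, fun c => ?_⟩
  filter_upwards [s.ae_ne_inner] with x hx hbox
  have hpiece : x ∈ s.piece j := by
    refine ⟨fun i => ?_, fun i => ?_⟩
    · exact (hn i).1.trans (cell_bounds_of_mem_box C hN0 hk hh hbox i).1
    · exact (cell_bounds_of_mem_box C hN0 hk hh hbox i).2.trans (hn i).2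
  refine ⟨s.piece_subset j hpiece, ?_⟩
  rw [s.cutCount_eq hpiece hx]
  exact hlabel

/-- For almost all thresholds, the parts of a splitting with few cuts do not all have the same
amount of each color and a `q`-th of the volume. -/
theorem volume_balanced_thresholds_eq_zero {d k N q t : ℕ} (C : Necklace d) {h : ℝ} (i₀ : Fin d)
    (c₀ : Fin k) (f : (Fin d → ℝ) → Fin k) (hq : 2 ≤ q) (hN : 2 * (q * (t + 1) ^ d) ≤ N)
    (h0 : 0 < h) (hh : h ≤ C.side / (N * k)) (ht : t ≤ (q - 1) * (k - 1)) (l₀ : Fin q) :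
    volume {θ : (Fin d → Fin N) × Fin k → ℝ | (∀ σ, θ σ ∈ Set.Ioo 0 h) ∧
      ∃ s : Splitting C q, s.size ≤ t ∧
        (∀ l, volume.real (region C s.inner s.label l) = C.side ^ d / q) ∧
        ∀ c l, colorVolume C h i₀ c₀ f s.label θ s.inner c l
          = colorVolume C h i₀ c₀ f s.label θ s.inner c l₀} = 0 := by
  have hN0 : 0 < N := lt_of_lt_of_le (by positivity) hN
  -- A countable union: `cuts` ranges over a countable set and the remaining data over finite sets.
  refine measure_mono_null (t := ⋃ (cuts : Fin d → ℕ)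
    (label : ((i : Fin d) → Fin (cuts i + 1)) → Fin q)
    (target : (Fin d → Fin N) × Fin k → Fin q)
    (e : (Σ i, Fin (cuts i)) ↪ (Fin d → Fin N) × Fin k),
    solveThresholds C h i₀ c₀ f label l₀ target e ''
      {w | MvPolynomial.eval w (partPoly C e label l₀) = C.side ^ d / q}) ?_ ?_
  swap
  · refine measure_iUnion_null fun cuts => measure_iUnion_null fun label =>
      measure_iUnion_null fun target => measure_iUnion_null fun e => ?_
    obtain ⟨K, hK⟩ := exists_lipschitzWith_solveThresholds C h0 i₀ c₀ f label l₀ target e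
    exact volume_image_eq_zero_of_lipschitz hK
      (volume_partPoly_eq_zero hq C e e.injective label l₀)
  rintro θ ⟨hθ, s, hs, hvol, hbal⟩
  choose n hn using fun l => exists_cell_subset_region (by omega) c₀.pos hN hh s hs l (hvol l)
  -- The counting step: each cut gets its own pair of a part other than `l₀` and a color other than
  -- `c₀`.
  have hcard : Fintype.card (Σ i, Fin (s.cuts i))
      ≤ Fintype.card ({l : Fin q // l ≠ l₀} × {c : Fin k // c ≠ c₀}) := by
    rw [Fintype.card_prod, Fintype.card_sigma]
    simp only [Fintype.card_fin, ne_eq, Fintype.card_subtype_compl, Fintype.card_unique]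
    exact le_trans hs ht
  obtain ⟨φ⟩ := Function.Embedding.nonempty_of_card_le hcard
  set e : (Σ i, Fin (s.cuts i)) → (Fin d → Fin N) × Fin k :=
    fun m => (n (φ m).1, (φ m).2) with he_def
  have he : Function.Injective e := by
    intro m m' hmm
    have h1 : n (φ m).1 = n (φ m').1 := congrArg Prod.fst hmm
    have h2 : ((φ m).2 : Fin k) = (φ m').2 := congrArg Prod.snd hmm
    refine φ.injective (Prod.ext (Subtype.ext ?_) (Subtype.ext h2))
    -- Two different parts cannot own the same cell, since a box of positive volume would lie almost
    -- everywhere in two disjoint regions.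
    by_contra hne
    have hnull : volume (box C h (e m)) = 0 := by
      refine measure_eq_zero_iff_ae_notMem.2 ?_
      have hm := hn (φ m).1 (φ m).2
      have hm' := hn (φ m').1 (φ m).2
      rw [← h1] at hm'
      filter_upwards [hm, hm'] with x hx hx' hmem
      exact hne ((hx hmem).2.symm.trans (hx' hmem).2)
    rw [volume_box C h0.le, ENNReal.ofReal_eq_zero] at hnull
    exact absurd (pow_pos h0 d) (not_lt.2 hnull)
  set target : (Fin d → Fin N) × Fin k → Fin q :=
    Function.extend e (fun m => ((φ m).1 : Fin q)) fun _ => l₀ with htarget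
  have htar : ∀ m, target (e m) = (φ m).1 := fun m => he.extend_apply _ _ m
  simp only [Set.mem_iUnion]
  refine ⟨s.cuts, s.label, target, ⟨e, he⟩, Function.extend e s.inner θ, ?_, ?_⟩
  · exact (eval_partPoly s e _ (fun m => he.extend_apply _ _ m) l₀).trans (hvol l₀)
  · refine solveThresholds_extend C i₀ c₀ f hN0 h0 hh s.label l₀ target e he θ hθ s.inner hbal
      (fun m => (φ m).2.2) (fun m => ?_) (fun m => ?_) fun m m' h1 h2 => ?_
    · rw [htar]
      exact (φ m).1.2
    · rw [htar]
      exact hn _ _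
    · rw [htar, htar] at h2
      exact φ.injective (Prod.ext (Subtype.ext h2) (Subtype.ext h1))

/-! ### Density of the colorings without fair splittings -/

theorem GlobalColoring.colorClass_restrict {d k : ℕ} (g : GlobalColoring d k) (C : Necklace d)
    (c : Fin k) : (g.restrict C).colorClass c = g.color ⁻¹' {c} ∩ C.toSet := by
  ext x
  simp [Coloring.colorClass, restrict, and_comm]

theorem GlobalColoring.sum_volume_real_inter {d k : ℕ} (g : GlobalColoring d k) (C : Necklace d)
    {R : Set (Fin d → ℝ)} (hR : MeasurableSet R) (hRC : R ⊆ C.toSet) :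
    ∑ c, volume.real (g.color ⁻¹' {c} ∩ R) = volume.real R := by
  have hunion : R = ⋃ c ∈ (Finset.univ : Finset (Fin k)), g.color ⁻¹' {c} ∩ R := by
    ext x
    simp
  have h := measure_biUnion_finset₀ (μ := volume) (s := (Finset.univ : Finset (Fin k)))
    (f := fun c => g.color ⁻¹' {c} ∩ R) (fun c _ c' _ hne =>
      (Set.disjoint_left.2 fun x hx hx' => hne (hx.1.symm.trans hx'.1)).aedisjoint)
    fun c _ => (g.measurable c).inter hR.nullMeasurableSet
  rw [← hunion] at h
  rw [measureReal_def, h, ENNReal.toReal_sum]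
  · rfl
  · exact fun c _ => C.volume_ne_top (Set.inter_subset_right.trans hRC)

/-- Every coloring of space can be changed in a subset of the cube of small volume to a coloring
whose restriction to the cube has no fair splitting with few cuts. -/
theorem GlobalColoring.exists_not_hasFairSplitting {d k t q : ℕ} (hd : 1 ≤ d) (hk : 1 ≤ k)
    (hq : 2 ≤ q) (ht : t ≤ (q - 1) * (k - 1)) (C : Necklace d) (f : GlobalColoring d k) {ε : ℝ}
    (hε : 0 < ε) :
    ∃ g : GlobalColoring d k, {x | f.color x ≠ g.color x} ⊆ C.toSet ∧
      volume.real {x | f.color x ≠ g.color x} < ε ∧ ¬ HasFairSplitting (g.restrict C) q t := by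
  set N : ℕ := 2 * (q * (t + 1) ^ d) with hN
  have hN0 : 0 < N := by positivity
  set ι := (Fin d → Fin N) × Fin k
  set M : ℝ := ((Fintype.card ι : ℕ) : ℝ) with hM
  have hM0 : 0 ≤ M := Nat.cast_nonneg _
  have hL := C.side_pos
  -- The bound `1` gives `h ^ d ≤ h`, the second keeps the boxes disjoint and inside the cube, and
  -- the third keeps the total volume of the `M` boxes below `ε`.
  set h : ℝ := min 1 (min (C.side / (N * k)) (ε / (M + 1))) with hh_def
  have h0 : 0 < h := by positivity
  have hh : h ≤ C.side / (N * k) := (min_le_right _ _).trans (min_le_left _ _)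
  have hhε : h ≤ ε / (M + 1) := (min_le_right _ _).trans (min_le_right _ _)
  have hpow : h ^ d ≤ h := by
    simpa using pow_le_pow_of_le_one h0.le (min_le_left _ _) hd
  set i₀ : Fin d := ⟨0, hd⟩
  set c₀ : Fin k := ⟨0, hk⟩
  set l₀ : Fin q := ⟨0, by omega⟩
  have hnull := volume_balanced_thresholds_eq_zero C i₀ c₀ f.color hq hN.ge h0 hh ht l₀
  obtain ⟨θ, hθ, hθn⟩ : ∃ θ : ι → ℝ, (∀ σ, θ σ ∈ Set.Ioo 0 h) ∧ ¬ ∃ s : Splitting C q,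
      s.size ≤ t ∧ (∀ l, volume.real (region C s.inner s.label l) = C.side ^ d / q) ∧
      ∀ c l, colorVolume C h i₀ c₀ f.color s.label θ s.inner c l
        = colorVolume C h i₀ c₀ f.color s.label θ s.inner c l₀ := by
    by_contra! hall
    have hpi : volume (Set.univ.pi fun _ : ι => Set.Ioo 0 h) = 0 := by
      refine measure_mono_null ?_ hnull
      intro θ hθ
      exact ⟨fun σ => hθ σ trivial, hall θ fun σ => hθ σ trivial⟩
    rw [volume_pi_pi] at hpi
    simp only [Real.volume_Ioo, sub_zero, Finset.prod_const, pow_eq_zero_iff', ne_eq,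
      ENNReal.ofReal_eq_zero] at hpi
    exact absurd hpi.1 (not_le.2 h0)
  set g : GlobalColoring d k := ⟨recolor C h i₀ c₀ f.color θ,
    nullMeasurableSet_recolor C i₀ c₀ f.color θ hN0 hh f.measurable⟩ with hg
  have hsub : {x | f.color x ≠ g.color x} ⊆ ⋃ σ : ι, box C h σ := by
    intro x hx
    by_contra hn
    simp only [Set.mem_iUnion, not_exists] at hn
    exact hx (recolor_of_notMem C i₀ c₀ f.color θ hn).symm
  have hbC : (⋃ σ : ι, box C h σ) ⊆ C.toSet :=
    Set.iUnion_subset fun σ => box_subset C hN0 hk hh σ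
  refine ⟨g, hsub.trans hbC, ?_, ?_⟩
  · have h1 : volume.real (⋃ σ : ι, box C h σ) ≤ M * h ^ d := by
      refine (measureReal_iUnion_fintype_le _).trans (le_of_eq ?_)
      have : ∀ σ : ι, volume.real (box C h σ) = h ^ d := fun σ => by
        rw [measureReal_def, volume_box C h0.le, ENNReal.toReal_ofReal (pow_nonneg h0.le _)]
      simp only [this]
      rw [Finset.sum_const, Finset.card_univ, nsmul_eq_mul]
    have h2 := (measureReal_mono hsub (C.volume_ne_top hbC)).trans h1
    have h3 : M * h ^ d ≤ M * (ε / (M + 1)) := mul_le_mul_of_nonneg_left (hpow.trans hhε) hM0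
    have h4 : M * (ε / (M + 1)) < ε := by
      rw [← mul_div_assoc, div_lt_iff₀ (by positivity)]
      linarith
    exact h2.trans_lt (h3.trans_lt h4)
  · rintro ⟨s, hs, hfair⟩
    have hcol : ∀ c l, colorVolume C h i₀ c₀ f.color s.label θ s.inner c l
        = volume.real (g.color ⁻¹' {c} ∩ C.toSet) / q := by
      intro c l
      have h1 := hfair l c
      rw [s.volume_inter_part, g.colorClass_restrict, Set.inter_assoc,
        Set.inter_eq_right.2 (show region C s.inner s.label l ⊆ C.toSet from fun x hx => hx.1)]
        at h1
      have h2 := congrArg ENNReal.toReal h1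
      rwa [ENNReal.toReal_div, ENNReal.toReal_natCast] at h2
    refine hθn ⟨s, hs, fun l => ?_, fun c l => (hcol c l).trans (hcol c l₀).symm⟩
    -- Summing fairness over all colors, including `c₀`, gives the volume equation.
    rw [← g.sum_volume_real_inter C (measurableSet_region C s.inner s.label l) fun x hx => hx.1]
    have h3 : ∀ c, volume.real (g.color ⁻¹' {c} ∩ region C s.inner s.label l)
        = volume.real (g.color ⁻¹' {c} ∩ C.toSet) / q := fun c => hcol c l
    simp only [h3]
    rw [← Finset.sum_div, g.sum_volume_real_inter C (R := C.toSet) measurableSet_Icc subset_rfl, measureReal_def,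
      C.volume_toSet, ENNReal.toReal_ofReal (pow_nonneg hL.le _)]

/-- Fair splittings only depend on the coloring up to null sets. -/
theorem HasFairSplitting.congr {d k q t : ℕ} {C : Necklace d} {f g : Coloring C k}
    (h : volume (f.disagreement g) = 0) (hf : HasFairSplitting f q t) :
    HasFairSplitting g q t := by
  obtain ⟨s, hs, hfair⟩ := hf
  have hae : ∀ c, f.colorClass c =ᵐ[volume] g.colorClass c := by
    intro c
    refine Filter.eventuallyEq_set.2 ?_
    filter_upwards [measure_eq_zero_iff_ae_notMem.1 h] with x hx
    constructor
    · rintro ⟨y, hy, rfl⟩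
      refine ⟨y, ?_, rfl⟩
      by_contra hne
      exact hx ⟨y, fun he => hne (he.symm.trans hy), rfl⟩
    · rintro ⟨y, hy, rfl⟩
      refine ⟨y, ?_, rfl⟩
      by_contra hne
      exact hx ⟨y, fun he => hne (he.trans hy), rfl⟩
  refine ⟨s, hs, fun l c => ?_⟩
  rw [← measure_congr (hae c), ← hfair l c]
  exact (measure_congr ((hae c).inter (Filter.EventuallyEq.refl _ _))).symm

/-- Extends a coloring of a cube to the whole space by the color `c₀`. -/
def Coloring.extend {d k : ℕ} {C : Necklace d} (f : Coloring C k) (c₀ : Fin k) :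
    GlobalColoring d k where
  color := Function.extend Subtype.val f.color fun _ => c₀
  measurable c := by
    have h : Function.extend Subtype.val f.color (fun _ => c₀) ⁻¹' {c}
        = f.colorClass c ∪ (C.toSetᶜ ∩ {_x | c₀ = c}) := by
      ext x
      by_cases hx : x ∈ C.toSet
      · have : Function.extend Subtype.val f.color (fun _ => c₀) x = f.color ⟨x, hx⟩ :=
          Subtype.val_injective.extend_apply f.color (fun _ => c₀) ⟨x, hx⟩
        rw [Set.mem_preimage, this]
        simp [Coloring.colorClass, hx]
      · simp [Coloring.colorClass, hx]
    rw [h]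
    exact (f.measurable c).union (measurableSet_Icc.compl.inter
      (MeasurableSet.const _)).nullMeasurableSet

theorem Coloring.extend_color {d k : ℕ} {C : Necklace d} (f : Coloring C k) (c₀ : Fin k)
    (x : C.toSet) : (f.extend c₀).color x = f.color x :=
  Subtype.val_injective.extend_apply f.color (fun _ => c₀) x

/-- A coloring of the cube is extended to space, perturbed there and restricted back. Every
representative of the resulting class is good, since fairness ignores null sets. -/
theorem Coloring.dense_not_hasFairSplitting {d k t q : ℕ} (hd : 1 ≤ d) (hk : 1 ≤ k)
    (hq : 2 ≤ q) (ht : t ≤ (q - 1) * (k - 1)) (C : Necklace d) :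
    Dense {F : ColoringSpace C k |
      ∀ f : Coloring C k, SeparationQuotient.mk f = F → ¬ HasFairSplitting f q t} := by
  refine Metric.dense_iff.2 fun F ε hε => ?_
  obtain ⟨f, rfl⟩ := SeparationQuotient.surjective_mk F
  obtain ⟨g, hgC, hgε, hg⟩ := GlobalColoring.exists_not_hasFairSplitting hd hk hq ht C
    (f.extend ⟨0, hk⟩) hε
  refine ⟨SeparationQuotient.mk (g.restrict C), ?_, fun f' hf' hfair => hg (hfair.congr ?_)⟩
  · rw [Metric.mem_ball, dist_comm, SeparationQuotient.dist_mk]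
    refine lt_of_le_of_lt (measureReal_mono ?_ (C.volume_ne_top hgC)) hgε
    rintro _ ⟨x, hx, rfl⟩
    change (f.extend ⟨0, hk⟩).color x ≠ g.color x
    rw [f.extend_color]
    exact hx
  · have h1 : dist f' (g.restrict C) = 0 :=
      Metric.inseparable_iff.1 (SeparationQuotient.mk_eq_mk.1 hf')
    exact (measureReal_eq_zero_iff (f'.volume_disagreement_ne_top _)).1 h1

theorem GlobalColoring.dist_le {d k : ℕ} (f g : GlobalColoring d k)
    (hfin : volume {x | f.color x ≠ g.color x} ≠ ⊤) :
    dist f g ≤ volume.real {x | f.color x ≠ g.color x} := by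
  set D := volume.real {x | f.color x ≠ g.color x} with hD
  have hsum : HasSum (fun n : ℕ => D / 2 / 2 ^ n) D := hasSum_geometric_two' D
  refine (Summable.tsum_le_tsum (fun n => ?_) (summable_distOn f g) hsum.summable).trans_eq
    hsum.tsum_eq
  have h1 : f.distOn g (n + 1) ≤ D := by
    refine (div_le_self measureReal_nonneg (one_le_pow₀ ?_)).trans
      (measureReal_mono (fun x hx => hx.2) hfin)
    push_cast
    have : (0 : ℝ) ≤ n := Nat.cast_nonneg n
    linarith
  rw [div_div, ← pow_succ']
  exact div_le_div_of_nonneg_right h1 (by positivity)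

/-- A vanishing sum of nonnegative terms makes every `diffSet` null, and the cubes `[-n, n]^d`
exhaust space. -/
theorem GlobalColoring.volume_ne_eq_zero {d k : ℕ} {f g : GlobalColoring d k}
    (h : dist f g = 0) : volume {x | f.color x ≠ g.color x} = 0 := by
  have h0 : ∀ n : ℕ, 0 ≤ f.distOn g (n + 1) / 2 ^ (n + 1) := fun n =>
    div_nonneg (distOn_nonneg f g _) (by positivity)
  have hs : HasSum (fun n : ℕ => f.distOn g (n + 1) / 2 ^ (n + 1)) 0 :=
    h ▸ (summable_distOn f g).hasSum
  have hz := (hasSum_zero_iff_of_nonneg h0).1 hs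
  have hdiff : ∀ n : ℕ, volume (f.diffSet g (n + 1)) = 0 := by
    intro n
    have h1 := congrFun hz n
    simp only [Pi.zero_apply, div_eq_zero_iff, distOn] at h1
    refine (measureReal_eq_zero_iff (f.volume_diffSet_ne_top g _)).1 ?_
    rcases h1 with (h1 | h1) | h1
    · exact h1
    · exact absurd h1 (by positivity)
    · exact absurd h1 (by positivity)
  refine measure_mono_null (fun x hx => ?_) (measure_iUnion_null hdiff)
  obtain ⟨n, hn⟩ := exists_nat_ge ‖x‖
  refine Set.mem_iUnion.2 ⟨n, ⟨fun i => ?_, fun i => ?_⟩, hx⟩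
  all_goals
    have h1 := abs_le.1 ((norm_le_pi_norm x i).trans hn)
    push_cast
    linarith [h1.1, h1.2]

theorem GlobalColoring.dense_not_hasFairSplitting {d k t q : ℕ} (hd : 1 ≤ d) (hk : 1 ≤ k)
    (hq : 2 ≤ q) (ht : t ≤ (q - 1) * (k - 1)) (C : Necklace d) :
    Dense {F : GlobalColoringSpace d k | ∀ f : GlobalColoring d k,
      SeparationQuotient.mk f = F → ¬ HasFairSplitting (f.restrict C) q t} := by
  refine Metric.dense_iff.2 fun F ε hε => ?_
  obtain ⟨f, rfl⟩ := SeparationQuotient.surjective_mk F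
  obtain ⟨g, hgC, hgε, hg⟩ := exists_not_hasFairSplitting hd hk hq ht C f hε
  refine ⟨SeparationQuotient.mk g, ?_, fun f' hf' hfair => hg (hfair.congr ?_)⟩
  · rw [Metric.mem_ball, dist_comm, SeparationQuotient.dist_mk]
    exact (f.dist_le g (C.volume_ne_top hgC)).trans_lt hgε
  · have h1 : dist f' g = 0 := Metric.inseparable_iff.1 (SeparationQuotient.mk_eq_mk.1 hf')
    refine measure_mono_null ?_ (volume_ne_eq_zero h1)
    rintro _ ⟨x, hx, rfl⟩
    exact hx

theorem exists_coloring_not_hasFairSplitting {d k t q : ℕ} (hd : 1 ≤ d) (hk : 1 ≤ k)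
    (hq : 2 ≤ q) (ht : t ≤ (q - 1) * (k - 1)) (C : Necklace d) :
    ∃ f : Coloring C k, ¬ HasFairSplitting f q t := by
  obtain ⟨g, -, -, hg⟩ := GlobalColoring.exists_not_hasFairSplitting hd hk hq ht C
    ⟨fun _ => ⟨0, hk⟩, fun c => (MeasurableSet.const _).nullMeasurableSet⟩ one_pos
  exact ⟨_, hg⟩

end NecklaceSplitting

end

/-! ### The main theorem -/

open NecklaceSplitting
theorem mainTheorem11 :
    (∀ d k t q : ℕ, 1 ≤ d → 1 ≤ k → 1 ≤ t → 2 ≤ q →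
      (k : ℤ) * ((q : ℤ) - 1) > (t : ℤ) + (q : ℤ) - 2 →
      ∀ C : Necklace d,
        (∃ f : Coloring C k, ¬ HasFairSplitting f q t) ∧
        Dense {F : ColoringSpace C k |
          ∀ f : Coloring C k, SeparationQuotient.mk f = F → ¬ HasFairSplitting f q t} ∧
        Dense {F : GlobalColoringSpace d k |
          ∀ f : GlobalColoring d k, SeparationQuotient.mk f = F →
            ¬ HasFairSplitting (f.restrict C) q t}) ∧
    (∀ d t : ℕ, 1 ≤ d → 1 ≤ t → ∀ C : Necklace d,
      IsLeast {k : ℕ | ∃ f : Coloring C k, ¬ HasFairSplitting f 2 t} (t + 1)) := by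
  constructor
  · intro d k t q hd hk _ hq hlt C
    -- Over the integers, `k * (q - 1) > t + q - 2` rearranges to `t < (q - 1) * (k - 1) + 1`.
    have ht : t ≤ (q - 1) * (k - 1) := by
      obtain ⟨k, rfl⟩ := Nat.exists_eq_add_of_le hk
      obtain ⟨q, rfl⟩ := Nat.exists_eq_add_of_le hq
      rw [Nat.add_sub_cancel_left, show 2 + q - 1 = q + 1 by omega]
      zify
      push_cast at hlt
      linarith
    exact ⟨exists_coloring_not_hasFairSplitting hd hk hq ht C,
      Coloring.dense_not_hasFairSplitting hd hk hq ht C,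
      GlobalColoring.dense_not_hasFairSplitting hd hk hq ht C⟩
  · intro d t hd _ C
    -- For `q = 2` and `k = t + 1` the bound `(q - 1) * (k - 1)` equals `t`; fewer colors are
    -- excluded by Hobby–Rice.
    refine ⟨exists_coloring_not_hasFairSplitting hd (by omega) le_rfl (by simp) C, ?_⟩
    rintro k ⟨f, hf⟩
    by_contra hk
    exact hf (hasFairSplitting_two hd (by omega) f)
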